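/- Let $k$ be a number field. For each nonzero prime ideal $\mathfrak{p}$ of the ring of integers of $k$, let $q_{\mathfrak{p}}$ denote its absolute norm, i.e. the cardinality of its residue field. Let $(s_{\mathfrak{p}})_{\mathfrak{p}}$ be a bounded family of non-negative real numbers indexed by these primes. For a positive integer $N$ put $$T_N=\{\mathfrak{p} : q_{\mathfrak{p}}<N\},\qquad \pi_k(N)=\#T_N .$$ If at least one of the two sequences $$\frac{1}{N}\sum_{\mathfrak{p}\in T_N}s_{\mathfrak{p}}\log q_{\mathfrak{p}}\qquad\text{and}\qquad \frac{1}{\pi_k(N)}\sum_{\mathfrak{p}\in T_N}s_{\mathfrak{p}}$$ (the second being defined for all $N$ large enough that $\pi_k(N)>0$) converges to a real number as $N\to\infty$, then both converge, and to the same limit. -/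

import Mathlib

open Filter Topology NumberField IsDedekindDomain

noncomputable section

namespace NumberFieldPrimes

variable (k : Type*) [Field k] [NumberField k]

/-- The absolute norm of a nonzero prime ideal `𝔭` of the ring of integers of `k`,
i.e. the cardinality of the residue field `𝓞 k ⧸ 𝔭`. -/
def primeNorm {k : Type*} [Field k] [NumberField k] (𝔭 : HeightOneSpectrum (𝓞 k)) : ℕ :=
  Ideal.absNorm 𝔭.asIdeal

/-- Only finitely many primes of `k` have norm less than `N`. -/
theorem finite_primeNorm_lt (N : ℕ) :
    {𝔭 : HeightOneSpectrum (𝓞 k) | primeNorm 𝔭 < N}.Finite := by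
  have h := Ideal.finite_setOfPred_absNorm_le (S := 𝓞 k) N
  refine Set.Finite.of_finite_image (f := fun 𝔭 => 𝔭.asIdeal) (h.subset ?_) ?_
  · rintro _ ⟨𝔭, h𝔭, rfl⟩
    exact le_of_lt (show Ideal.absNorm 𝔭.asIdeal < N from h𝔭)
  · intro a _ b _ hab
    exact HeightOneSpectrum.ext hab

/-- The set `T_N` of primes of `k` of norm less than `N`. -/
def primesBelow (N : ℕ) : Finset (HeightOneSpectrum (𝓞 k)) :=
  (finite_primeNorm_lt k N).toFinset

/-- The prime counting function `π_k(N) = #T_N`. -/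
def primeCount (N : ℕ) : ℕ := (primesBelow k N).card

/-- The `N`-th term `(1 / N) ∑_{𝔭 ∈ T_N} s_𝔭 log q_𝔭`. -/
def logAverage (s : HeightOneSpectrum (𝓞 k) → ℝ) (N : ℕ) : ℝ :=
  (1 / (N : ℝ)) * ∑ 𝔭 ∈ primesBelow k N, s 𝔭 * Real.log (primeNorm 𝔭 : ℝ)

/-- The `N`-th term `(1 / π_k(N)) ∑_{𝔭 ∈ T_N} s_𝔭` (it makes sense for all large `N`; for the
finitely many `N` with `π_k(N) = 0` the value is `0`). -/
def primeAverage (s : HeightOneSpectrum (𝓞 k) → ℝ) (N : ℕ) : ℝ :=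
  (1 / (primeCount k N : ℝ)) * ∑ 𝔭 ∈ primesBelow k N, s 𝔭

end NumberFieldPrimes

end

/-! ### A Tauberian theorem for Laplace transforms. -/

section Tauberian

open MeasureTheory FourierTransform Convolution ComplexConjugate

/-! Write θ(N) for the sum of log q over the primes of norm q < N. Since 0 ≤ s ≤ M, replacing each
log q by log N in ∑ s log q increases the sum by at least 0 and at most M ∑ (log N - log q) = M
(π_k(N) log N - θ(N)). If this bound is o(N), the first average differs by o(1) from (log N / N) ∑
s, which is the second average times π_k(N) log N / N. If moreover this last factor tends to 1, the
two averages converge together and to the same limit. These final steps are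
`tendsto_log_div_mul_sum_sub_logAverage` and `log_div_mul_sum_eq`.

Both inputs follow from the prime ideal theorem θ(N) ~ N (`tendsto_sum_log_primeNorm_div`): cutting
the primes at N^(1-δ) shows that log q is close to log N for all but a negligible part of them.

The prime ideal theorem is proved analytically, in four stages. Counting lattice points in dilates
of a fundamental domain, whose ε-boundary layer has volume O(√ε), shows that the number of ideals of
norm at most s is ρs + O(s^θ) with ρ > 0 and θ < 1 (`exists_card_absNorm_le_sub_isBigO`). Abel
summation then continues (s - 1)ζ_k(s) holomorphically past the line Re s = 1, with nonzero value at
1. The Euler product and the 3-4-1 inequality exclude zeros on that line, so ∑ log q · q^(-s) - 1/(s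
- 1) extends continuously to Re s ≥ 1. Finally a Wiener–Ikehara argument (`tendsto_one_of_laplace`),
together with the Chebyshev bound θ(n + 1) ≤ [k:ℚ] n log 4, gives θ(N) ~ N. -/

/-- A nonnegative integrable kernel of mass one which is the Fourier transform of a continuous
function with compact support. -/
theorem exists_bandlimited_kernel : ∃ (w : ℝ → ℂ) (k : ℝ → ℝ), Continuous w ∧
    HasCompactSupport w ∧ (∀ v, (k v : ℂ) = 𝓕 w v) ∧ (∀ v, 0 ≤ k v) ∧ Continuous k ∧
    Integrable k ∧ ∫ v, k v = 1 := by
  -- The bump is real and even, so its transform is real and its self-convolution has transform |𝓕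
  -- h|². This makes the kernel nonnegative while `w` keeps compact support.
  let b : ContDiffBump (0 : ℝ) := default
  let h : ℝ → ℂ := fun t ↦ ((b t : ℝ) : ℂ)
  have hsupp : HasCompactSupport h :=
    b.hasCompactSupport.comp_left (g := fun x : ℝ ↦ (x : ℂ)) (by simp)
  have hsm : ContDiff ℝ (⊤ : ℕ∞) h := Complex.ofRealCLM.contDiff.comp b.contDiff
  have hcont : Continuous h := hsm.continuous
  have hint : Integrable h := hcont.integrable_of_hasCompactSupport hsupp
  let S : SchwartzMap ℝ ℂ := hsupp.toSchwartzMap hsm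
  have hS : (S : ℝ → ℂ) = h := rfl
  have hFS : ((𝓕 S : SchwartzMap ℝ ℂ) : ℝ → ℂ) = 𝓕 h := by
    rw [SchwartzMap.fourier_coe, hS]
  have hreal : ∀ v, conj (𝓕 h v) = 𝓕 h v := by
    intro v
    rw [Real.fourier_real_eq, ← integral_conj]
    rw [← integral_neg_eq_self]
    congr 1
    ext t
    have : b (-t) = b t := b.neg t
    simp [h, Circle.smul_def, this, Real.fourierChar_apply, ← Complex.exp_conj, map_ofNat]
  let w : ℝ → ℂ := h ⋆[ContinuousLinearMap.mul ℂ ℂ] h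
  have hFw : ∀ v, 𝓕 w v = ((‖𝓕 h v‖ ^ 2 : ℝ) : ℂ) := by
    intro v
    rw [Real.fourier_mul_convolution_eq hint hint]
    nth_rw 2 [← hreal v]
    rw [Complex.mul_conj, Complex.normSq_eq_norm_sq]
  have hcF : Continuous (𝓕 h) := hFS ▸ (𝓕 S : SchwartzMap ℝ ℂ).continuous
  have hkint : Integrable (fun v ↦ ‖𝓕 h v‖ ^ 2) := by
    have : MemLp (𝓕 h) 2 := hFS ▸ (𝓕 S : SchwartzMap ℝ ℂ).memLp 2
    exact this.integrable_norm_pow (by norm_num)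
  have hkpos : 0 < ∫ v, ‖𝓕 h v‖ ^ 2 := by
    rw [integral_pos_iff_support_of_nonneg (fun v ↦ by positivity) hkint]
    refine IsOpen.measure_pos _ ?_ ⟨0, ?_⟩
    · exact (hcF.norm.pow 2).isOpen_support
    · have : 𝓕 h 0 = ((∫ t, b t : ℝ) : ℂ) := by
        rw [Real.fourier_real_eq, ← integral_complex_ofReal]
        simp [h]
      have h2 : 0 < ∫ t, b t := b.integral_pos
      simp only [Function.mem_support, this]
      simp [h2.ne']
  set c : ℝ := ∫ v, ‖𝓕 h v‖ ^ 2
  refine ⟨fun t ↦ (c⁻¹ : ℝ) • w t, fun v ↦ c⁻¹ * ‖𝓕 h v‖ ^ 2, ?_, ?_, ?_, ?_, ?_, ?_, ?_⟩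
  · have hwc : Continuous w :=
      hsupp.continuous_convolution_right (ContinuousLinearMap.mul ℂ ℂ) hint.locallyIntegrable hcont
    exact hwc.const_smul (c⁻¹ : ℝ)
  · exact (hsupp.convolution _ hsupp).smul_left (f := fun _ ↦ (c⁻¹ : ℝ))
  · intro v
    have := hFw v
    rw [Real.fourier_real_eq] at this ⊢
    simp_rw [smul_comm _ (c⁻¹ : ℝ)]
    rw [integral_smul, this]
    simp
  · intro v; positivity
  · fun_prop
  · exact hkint.const_mul _
  · rw [integral_const_mul]; exact inv_mul_cancel₀ hkpos.ne'

/-- Fubini turns the convolution, damped by exp(-εu), into a Fourier integral of `w` times `G` on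
the line Re s = ε. Compact support of `w` means that only a compact piece of that line matters, so ε
→ 0 is allowed by continuity of `G` up to the boundary. The Riemann–Lebesgue lemma then gives decay
in `y`. -/
theorem tendsto_integral_mul_kernel {f : ℝ → ℝ} {M : ℝ} (hf : Measurable f) (hM : ∀ u, |f u| ≤ M)
    {G : ℂ → ℂ} (hG : ContinuousOn G {s | 0 ≤ s.re})
    (hfG : ∀ s : ℂ, 0 < s.re → ∫ u in Set.Ioi (0 : ℝ), (f u : ℂ) * Complex.exp (-s * u) = G s)
    {w : ℝ → ℂ} {k : ℝ → ℝ} (hw : Continuous w) (hws : HasCompactSupport w)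
    (hk : ∀ v, (k v : ℂ) = 𝓕 w v) (hkc : Continuous k) (hki : Integrable k) :
    Tendsto (fun y ↦ ∫ u in Set.Ioi (0 : ℝ), f u * k (y - u)) atTop (𝓝 0) := by
  have hM0 : 0 ≤ M := (abs_nonneg _).trans (hM 0)
  have hwi : Integrable w := hw.integrable_of_hasCompactSupport hws
  have key : ∀ ε : ℝ, 0 < ε → ∀ y : ℝ,
      ∫ u in Set.Ioi (0 : ℝ), ((f u * k (y - u) : ℝ) : ℂ) * Real.exp (-ε * u) =
        ∫ t : ℝ, Real.fourierChar (-(t * y)) • (w t * G (ε - 2 * Real.pi * t * Complex.I)) := by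
    intro ε hε y
    have h1 : ∀ u : ℝ, ((f u * k (y - u) : ℝ) : ℂ) * Real.exp (-ε * u) =
        ∫ t : ℝ, (Real.fourierChar (-(t * (y - u))) • w t) * ((f u : ℂ) * Real.exp (-ε * u)) := by
      intro u
      rw [integral_mul_const, ← Real.fourier_real_eq, ← hk]
      push_cast; ring
    have hei : IntegrableOn (fun u : ℝ ↦ (f u : ℂ) * Real.exp (-ε * u)) (Set.Ioi 0) := by
      have : IntegrableOn (fun u : ℝ ↦ ((Real.exp (-ε * u) : ℝ) : ℂ)) (Set.Ioi 0) :=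
        (integrableOn_exp_mul_Ioi (a := -ε) (by linarith) 0).ofReal
      refine this.bdd_mul (c := M) (by fun_prop) ?_
      filter_upwards with u
      simpa using hM u
    simp_rw [h1]
    rw [integral_integral_swap]
    · congr 1
      ext t
      rw [← hfG _ (by simpa using hε)]
      simp only [Circle.smul_def, smul_eq_mul, Real.fourierChar_apply]
      rw [← mul_assoc, ← integral_const_mul]
      congr 1
      ext u
      have : Complex.exp (-(ε - 2 * Real.pi * t * Complex.I) * u) =
        Complex.exp (2 * Real.pi * t * u * Complex.I) * Complex.exp (-ε * u) := by
        rw [← Complex.exp_add]; congr 1; ring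
      rw [this]
      have h3 : Complex.exp (↑(2 * Real.pi * -(t * (y - u))) * Complex.I) =
        Complex.exp (↑(2 * Real.pi * -(t * y)) * Complex.I) *
          Complex.exp (2 * Real.pi * t * u * Complex.I) := by
        rw [← Complex.exp_add]; congr 1; push_cast; ring
      rw [h3]
      push_cast
      ring
    · have h4 : Integrable (fun p : ℝ × ℝ ↦ ((f p.1 : ℂ) * Real.exp (-ε * p.1)) * w p.2)
          ((volume.restrict (Set.Ioi 0)).prod volume) := hei.mul_prod hwi
      refine h4.mono ?_ ?_
      · have : Measurable w := hw.measurable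
        refine Measurable.aestronglyMeasurable ?_
        simp only [Function.uncurry_def, Circle.smul_def, smul_eq_mul]
        have h6 : Continuous fun p : ℝ × ℝ ↦ ((Real.fourierChar (-(p.2 * (y - p.1)))) : ℂ) := by
          fun_prop
        have := h6.measurable
        fun_prop
      · filter_upwards with p
        simp only [Function.uncurry_def, norm_mul, Circle.norm_smul]
        rw [mul_comm]
  have lim1 : ∀ y : ℝ, Tendsto (fun ε : ℝ ↦
      ∫ u in Set.Ioi (0 : ℝ), ((f u * k (y - u) : ℝ) : ℂ) * Real.exp (-ε * u)) (𝓝[>] 0)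
      (𝓝 (∫ u in Set.Ioi (0 : ℝ), ((f u * k (y - u) : ℝ) : ℂ))) := by
    intro y
    refine tendsto_integral_filter_of_dominated_convergence (fun u ↦ M * |k (y - u)|) ?_ ?_ ?_ ?_
    · filter_upwards with ε
      have := hkc.measurable
      exact Measurable.aestronglyMeasurable (by fun_prop)
    · filter_upwards [self_mem_nhdsWithin] with ε hε
      filter_upwards [ae_restrict_mem measurableSet_Ioi] with u hu
      rw [norm_mul, Complex.norm_real, Complex.norm_real, Real.norm_eq_abs, Real.norm_eq_abs,
          abs_mul,
        Real.abs_exp]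
      have h1 : Real.exp (-ε * u) ≤ 1 := by
        rw [Real.exp_le_one_iff]
        have : 0 < ε * u := mul_pos hε hu
        linarith
      calc |f u| * |k (y - u)| * Real.exp (-ε * u) ≤ |f u| * |k (y - u)| * 1 := by gcongr
        _ ≤ M * |k (y - u)| := by rw [mul_one]; gcongr; exact hM u
    · exact ((hki.comp_sub_left y).abs.const_mul M).integrableOn
    · filter_upwards with u
      have : Tendsto (fun ε : ℝ ↦ ((f u * k (y - u) : ℝ) : ℂ) * Real.exp (-ε * u)) (𝓝 0)
          (𝓝 (((f u * k (y - u) : ℝ) : ℂ) * Real.exp (-0 * u))) := by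
        apply Continuous.tendsto
          (f := fun ε : ℝ ↦ ((f u * k (y - u) : ℝ) : ℂ) * Real.exp (-ε * u))
        fun_prop
      simpa using this.mono_left nhdsWithin_le_nhds
  have hGc : ∀ t : ℝ, Tendsto (fun ε : ℝ ↦ G (ε - 2 * Real.pi * t * Complex.I)) (𝓝[>] 0)
      (𝓝 (G (0 - 2 * Real.pi * t * Complex.I))) := by
    intro t
    have h1 := hG (0 - 2 * Real.pi * t * Complex.I) (by simp)
    refine h1.tendsto.comp (tendsto_nhdsWithin_iff.mpr ⟨?_, ?_⟩)
    · have : Tendsto (fun ε : ℝ ↦ ((ε : ℂ) - 2 * Real.pi * t * Complex.I)) (𝓝 0)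
          (𝓝 (((0 : ℝ) : ℂ) - 2 * Real.pi * t * Complex.I)) :=
        Continuous.tendsto (f := fun ε : ℝ ↦ ((ε : ℂ) - 2 * Real.pi * t * Complex.I))
          (by fun_prop) 0
      simpa using this.mono_left nhdsWithin_le_nhds
    · filter_upwards [self_mem_nhdsWithin] with ε hε
      simpa using (le_of_lt hε)
  -- A bound for `G` on the compact rectangle 0 ≤ ε ≤ 1, |t| ≤ R supplies the dominating function
  -- for the limit ε → 0.
  obtain ⟨R, hR⟩ := hws.isCompact.isBounded.exists_norm_le
  have hKc : IsCompact ((fun p : ℝ × ℝ ↦ ((p.1 : ℂ) - 2 * Real.pi * p.2 * Complex.I)) ''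
      (Set.Icc 0 1 ×ˢ Set.Icc (-R) R)) :=
    (isCompact_Icc.prod isCompact_Icc).image (by fun_prop)
  obtain ⟨B, hB⟩ := hKc.exists_bound_of_continuousOn (f := G) (hG.mono (by
    rintro _ ⟨p, hp, rfl⟩
    simpa using hp.1.1))
  have hGline : Continuous fun t : ℝ ↦ G (0 - 2 * Real.pi * t * Complex.I) :=
    hG.comp_continuous (by fun_prop) (by simp)
  have lim2 : ∀ y : ℝ, Tendsto (fun ε : ℝ ↦ ∫ t : ℝ, Real.fourierChar (-(t * y)) •
      (w t * G (ε - 2 * Real.pi * t * Complex.I))) (𝓝[>] 0)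
      (𝓝 (∫ t : ℝ, Real.fourierChar (-(t * y)) • (w t * G (0 - 2 * Real.pi * t * Complex.I)))) := by
    intro y
    refine tendsto_integral_filter_of_dominated_convergence (fun t ↦ ‖w t‖ * B) ?_ ?_ ?_ ?_
    · filter_upwards [self_mem_nhdsWithin] with ε hε
      have h1 : Continuous fun t : ℝ ↦ G (ε - 2 * Real.pi * t * Complex.I) :=
        hG.comp_continuous (by fun_prop) (by intro t; simpa using le_of_lt hε)
      have h2 : Continuous fun t : ℝ ↦ Real.fourierChar (-(t * y)) := by fun_prop
      exact (h2.smul (hw.mul h1)).aestronglyMeasurable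
    · filter_upwards [Ioo_mem_nhdsGT (zero_lt_one' ℝ)] with ε hε
      filter_upwards with t
      rw [Circle.norm_smul, norm_mul]
      by_cases ht : w t = 0
      · simp [ht]
      · have htR := hR t (subset_tsupport _ ht)
        gcongr
        refine hB _ ⟨(ε, t), ⟨⟨hε.1.le, hε.2.le⟩, abs_le.mp htR⟩, rfl⟩
    · exact hwi.norm.mul_const B
    · filter_upwards with t
      exact ((hGc t).const_mul (w t)).const_smul _
  have eq0 : ∀ y : ℝ, ((∫ u in Set.Ioi (0 : ℝ), f u * k (y - u) : ℝ) : ℂ) =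
      ∫ t : ℝ, Real.fourierChar (-(t * y)) • (w t * G (0 - 2 * Real.pi * t * Complex.I)) := by
    intro y
    rw [← integral_complex_ofReal]
    refine tendsto_nhds_unique (lim1 y) ((lim2 y).congr' ?_)
    filter_upwards [self_mem_nhdsWithin] with ε hε
    exact (key ε hε y).symm
  have hRL := (Real.tendsto_integral_exp_smul_cocompact
    (fun t : ℝ ↦ w t * G (0 - 2 * Real.pi * t * Complex.I))).mono_left
      (atTop_le_cocompact)
  have : Tendsto (fun y ↦ ((∫ u in Set.Ioi (0 : ℝ), f u * k (y - u) : ℝ) : ℂ)) atTop (𝓝 0) :=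
    hRL.congr fun y ↦ (eq0 y).symm
  exact_mod_cast Complex.continuous_re.tendsto 0 |>.comp this

/-- Compressing a fixed kernel by the factor l / η moves the mass of [-l, l] into [-η, η]. On the
other side it stretches `w`, whose support remains compact. -/
theorem exists_concentrated_kernel {ε η : ℝ} (hε : 0 < ε) (hη : 0 < η) :
    ∃ (w : ℝ → ℂ) (k : ℝ → ℝ), Continuous w ∧
    HasCompactSupport w ∧ (∀ v, (k v : ℂ) = 𝓕 w v) ∧ (∀ v, 0 ≤ k v) ∧ Continuous k ∧
    Integrable k ∧ ∫ v, k v = 1 ∧ 1 - ε ≤ ∫ v in (-η)..η, k v := by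
  obtain ⟨w, k, hw, hws, hk, hk0, hkc, hki, hk1⟩ := exists_bandlimited_kernel
  have hlim : Tendsto (fun l : ℝ ↦ ∫ v in (-l)..l, k v) atTop (𝓝 1) :=
    hk1 ▸ intervalIntegral_tendsto_integral hki tendsto_neg_atTop_atBot tendsto_id
  obtain ⟨l, hl, hl0⟩ := ((hlim.eventually (lt_mem_nhds (by linarith : 1 - ε < 1))).and
    (eventually_gt_atTop 0)).exists
  have hc : 0 < l / η := by positivity
  refine ⟨fun t ↦ w (t / (l / η)), fun v ↦ (l / η) * k ((l / η) * v), by fun_prop, ?_, ?_, ?_,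
    by fun_prop, ?_, ?_, ?_⟩
  · simpa [div_eq_inv_mul] using hws.comp_smul (inv_ne_zero hc.ne')
  · intro v
    push_cast
    rw [hk, Real.fourier_real_eq, Real.fourier_real_eq]
    have := Measure.integral_comp_div
      (fun t ↦ Real.fourierChar (-(t * (l / η * v))) • w t) (l / η)
    rw [abs_of_pos hc] at this
    rw [← Complex.ofReal_div, ← Complex.real_smul, ← this]
    congr 1
    ext t
    have h9 : t / (l / η) * (l / η * v) = t * v := by field_simp
    rw [h9]
  · intro v
    exact mul_nonneg hc.le (hk0 _)
  · exact (hki.comp_mul_left' hc.ne').const_mul _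
  · rw [integral_const_mul, Measure.integral_comp_mul_left, hk1, abs_of_pos (by positivity)]
    simp only [smul_eq_mul, mul_one]
    exact mul_inv_cancel₀ hc.ne'
  · rw [intervalIntegral.integral_const_mul, intervalIntegral.mul_integral_comp_mul_left]
    rw [mul_neg, div_mul_cancel₀ _ hη.ne']
    exact hl.le

/-- Averages of `B` against a concentrated kernel tend to 1. Monotonicity of exp(u) B(u) prevents
`B` from dropping by more than a factor exp(-2ε) across a window of length 2ε, so values of `B` at
the ends of the window are controlled by the average over it. -/
theorem tendsto_one_of_laplace {B : ℝ → ℝ} {M : ℝ} (hB0 : ∀ u, 0 ≤ B u) (hBM : ∀ u, B u ≤ M)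
    (hmono : Monotone fun u ↦ Real.exp u * B u)
    {G : ℂ → ℂ} (hG : ContinuousOn G {s | 0 ≤ s.re})
    (hfG : ∀ s : ℂ, 0 < s.re →
      ∫ u in Set.Ioi (0 : ℝ), ((B u - 1 : ℝ) : ℂ) * Complex.exp (-s * u) = G s) :
    Tendsto B atTop (𝓝 1) := by
  have hM0 : 0 ≤ M := (hB0 0).trans (hBM 0)
  have hBmeas : Measurable B := by
    have : B = fun u ↦ Real.exp (-u) * (Real.exp u * B u) := by
      ext u; rw [← mul_assoc, ← Real.exp_add]; simp
    rw [this]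
    exact (by fun_prop : Measurable fun u : ℝ ↦ Real.exp (-u)).mul hmono.measurable
  have hslow : ∀ u v, u ≤ v → B u ≤ Real.exp (v - u) * B v := by
    intro u v huv
    have h := hmono huv
    simp only at h
    rw [Real.exp_sub, div_mul_eq_mul_div, le_div_iff₀ (Real.exp_pos _)]
    linarith
  -- In the upper bound the window has kernel mass at least 1 - ε and the average is at most 1 + ε.
  -- In the lower bound the average is at least 1 - 2ε and the part outside the window contributes
  -- at most Mε.
  have main : ∀ ε : ℝ, 0 < ε → ε < 1 →
      ∀ᶠ y in atTop, B y ≤ Real.exp (2 * ε) * ((1 + ε) / (1 - ε)) ∧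
        (1 - 2 * ε - M * ε) * Real.exp (-(2 * ε)) ≤ B y := by
    intro ε hε hε1
    obtain ⟨w, k, hw, hws, hk, hk0, hkc, hki, hk1, hkη⟩ := exists_concentrated_kernel hε hε
    have hlim := tendsto_integral_mul_kernel (f := fun u ↦ B u - 1) (M := M + 1)
      (by fun_prop) (fun u ↦ abs_le.mpr ⟨by linarith [hB0 u], by linarith [hBM u]⟩) hG hfG
      hw hws hk hkc hki
    have hev : ∀ᶠ y in atTop, |∫ u in Set.Ioi (0 : ℝ), (B u - 1) * k (y - u)| < ε := by
      have := hlim.abs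
      rw [abs_zero] at this
      exact this.eventually (gt_mem_nhds hε)
    have hkint : ∀ y, Integrable fun u ↦ k (y - u) := fun y ↦ hki.comp_sub_left y
    have hBkint : ∀ y, Integrable fun u ↦ B u * k (y - u) := fun y ↦
      (hkint y).bdd_mul (c := M) hBmeas.aestronglyMeasurable
        (by filter_upwards with u; rw [Real.norm_eq_abs, abs_of_nonneg (hB0 u)]; exact hBM u)
    have hTall : ∀ y, ∫ u, k (y - u) = 1 := fun y ↦ by rw [integral_sub_left_eq_self k, hk1]
    have hwin : ∀ y, ∫ u in Set.Icc (y - ε) (y + ε), k (y - u) = ∫ v in (-ε)..ε, k v := by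
      intro y
      rw [integral_Icc_eq_integral_Ioc, ← intervalIntegral.integral_of_le (by linarith),
        intervalIntegral.integral_comp_sub_left]
      congr 1 <;> ring
    have hT : ∀ᶠ y in atTop, 1 - 2 * ε ≤ ∫ u in Set.Ioi (0 : ℝ), B u * k (y - u) ∧
        ∫ u in Set.Ioi (0 : ℝ), B u * k (y - u) ≤ 1 + ε := by
      filter_upwards [hev, eventually_gt_atTop ε] with y hy hyε
      have h1 : ∫ u in Set.Ioi (0 : ℝ), (B u - 1) * k (y - u) =
          (∫ u in Set.Ioi (0 : ℝ), B u * k (y - u)) - ∫ u in Set.Ioi (0 : ℝ), k (y - u) := by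
        rw [← integral_sub (hBkint y).integrableOn (hkint y).integrableOn]
        congr 1; ext u; ring
      have h2 : ∫ u in Set.Ioi (0 : ℝ), k (y - u) ≤ 1 := by
        rw [← hTall y]
        exact setIntegral_le_integral (hkint y) (Eventually.of_forall fun u ↦ hk0 _)
      have h3 : 1 - ε ≤ ∫ u in Set.Ioi (0 : ℝ), k (y - u) := by
        refine (hkη.trans (hwin y).ge).trans ?_
        refine setIntegral_mono_set (hkint y).integrableOn
          (Eventually.of_forall fun u ↦ hk0 _) (LE.le.eventuallyLE ?_)
        intro u hu
        exact lt_of_lt_of_le (by linarith) hu.1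
      rw [h1, abs_lt] at hy
      constructor <;> linarith [hy.1, hy.2]
    have hup : ∀ᶠ y in atTop, B (y - ε) ≤ Real.exp (2 * ε) * ((1 + ε) / (1 - ε)) := by
      filter_upwards [hT, eventually_gt_atTop ε] with y hy hyε
      have h1 : B (y - ε) * Real.exp (-(2 * ε)) * (1 - ε) ≤ 1 + ε := by
        refine le_trans ?_ hy.2
        calc B (y - ε) * Real.exp (-(2 * ε)) * (1 - ε)
            ≤ B (y - ε) * Real.exp (-(2 * ε)) * ∫ u in Set.Icc (y - ε) (y + ε), k (y - u) := by
              rw [hwin y]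
              exact mul_le_mul_of_nonneg_left hkη (mul_nonneg (hB0 _) (Real.exp_pos _).le)
          _ = ∫ u in Set.Icc (y - ε) (y + ε), B (y - ε) * Real.exp (-(2 * ε)) * k (y - u) := by
              rw [integral_const_mul]
          _ ≤ ∫ u in Set.Icc (y - ε) (y + ε), B u * k (y - u) := by
              refine setIntegral_mono_on ((hkint y).const_mul _).integrableOn
                (hBkint y).integrableOn measurableSet_Icc fun u hu ↦ ?_
              refine mul_le_mul_of_nonneg_right ?_ (hk0 _)
              have h5 := hslow _ _ hu.1
              have h6 : Real.exp (u - (y - ε)) ≤ Real.exp (2 * ε) :=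
                Real.exp_le_exp.mpr (by linarith [hu.2])
              rw [Real.exp_neg, ← div_eq_mul_inv, div_le_iff₀ (Real.exp_pos _), mul_comm (B u)]
              exact h5.trans (mul_le_mul_of_nonneg_right h6 (hB0 _))
          _ ≤ _ := by
              refine setIntegral_mono_set (hBkint y).integrableOn
                (Eventually.of_forall fun u ↦ mul_nonneg (hB0 _) (hk0 _))
                (LE.le.eventuallyLE ?_)
              intro u hu
              exact lt_of_lt_of_le (by linarith) hu.1
      rw [Real.exp_neg, ← div_eq_mul_inv, div_mul_eq_mul_div, div_le_iff₀ (Real.exp_pos _),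
        ← le_div_iff₀ (by linarith)] at h1
      calc _ ≤ _ := h1
        _ = _ := by ring
    have hlow : ∀ᶠ y in atTop, (1 - 2 * ε - M * ε) * Real.exp (-(2 * ε)) ≤ B (y + ε) := by
      filter_upwards [hT, eventually_gt_atTop ε] with y hy hyε
      have h1 : 1 - 2 * ε ≤ B (y + ε) * Real.exp (2 * ε) + M * ε := by
        refine hy.1.trans ?_
        calc ∫ u in Set.Ioi (0 : ℝ), B u * k (y - u)
            ≤ ∫ u, B u * k (y - u) := setIntegral_le_integral (hBkint y)
              (Eventually.of_forall fun u ↦ mul_nonneg (hB0 _) (hk0 _))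
          _ = (∫ u in Set.Icc (y - ε) (y + ε), B u * k (y - u)) +
              ∫ u in (Set.Icc (y - ε) (y + ε))ᶜ, B u * k (y - u) :=
              (integral_add_compl measurableSet_Icc (hBkint y)).symm
          _ ≤ (∫ u in Set.Icc (y - ε) (y + ε), B (y + ε) * Real.exp (2 * ε) * k (y - u)) +
              ∫ u in (Set.Icc (y - ε) (y + ε))ᶜ, M * k (y - u) := by
              gcongr ?_ + ?_
              · refine setIntegral_mono_on (hBkint y).integrableOn
                  ((hkint y).const_mul _).integrableOn measurableSet_Icc fun u hu ↦ ?_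
                refine mul_le_mul_of_nonneg_right ?_ (hk0 _)
                have h5 := hslow _ _ hu.2
                have h6 : Real.exp (y + ε - u) ≤ Real.exp (2 * ε) :=
                  Real.exp_le_exp.mpr (by linarith [hu.1])
                rw [mul_comm (B (y + ε))]
                exact h5.trans (mul_le_mul_of_nonneg_right h6 (hB0 _))
              · exact setIntegral_mono (hBkint y).integrableOn
                  ((hkint y).const_mul _).integrableOn
                  fun u ↦ mul_le_mul_of_nonneg_right (hBM u) (hk0 _)
          _ ≤ _ := by
              rw [integral_const_mul, integral_const_mul]
              have h7 := integral_add_compl (measurableSet_Icc (a := y - ε) (b := y + ε)) (hkint y)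
              rw [hTall] at h7
              have h8 := hwin y
              have h9 : 0 ≤ ∫ u in (Set.Icc (y - ε) (y + ε))ᶜ, k (y - u) :=
                integral_nonneg fun u ↦ hk0 _
              refine add_le_add (mul_le_of_le_one_right
                (mul_nonneg (hB0 _) (Real.exp_pos _).le) (by linarith))
                (mul_le_mul_of_nonneg_left (by linarith) hM0)
      rw [Real.exp_neg, ← div_eq_mul_inv, div_le_iff₀ (Real.exp_pos _)]
      linarith
    have h1 := (tendsto_atTop_add_const_right atTop ε tendsto_id).eventually hup
    have h2 := (tendsto_atTop_add_const_right atTop (-ε) tendsto_id).eventually hlow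
    filter_upwards [h1, h2] with y hy1 hy2
    simp only [id, add_sub_cancel_right, neg_add_cancel_right] at hy1 hy2
    exact ⟨hy1, hy2⟩
  rw [tendsto_order]
  have hε : Tendsto (fun ε : ℝ ↦ ε) (𝓝[>] 0) (𝓝 0) := tendsto_id.mono_left nhdsWithin_le_nhds
  constructor
  · intro a ha
    have hl : Tendsto (fun ε : ℝ ↦ (1 - 2 * ε - M * ε) * Real.exp (-(2 * ε))) (𝓝[>] 0) (𝓝 1) := by
      have : Tendsto (fun ε : ℝ ↦ (1 - 2 * ε - M * ε) * Real.exp (-(2 * ε))) (𝓝 0)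
          (𝓝 ((1 - 2 * 0 - M * 0) * Real.exp (-(2 * 0)))) := by
        apply Continuous.tendsto (f := fun ε : ℝ ↦ (1 - 2 * ε - M * ε) * Real.exp (-(2 * ε)))
        fun_prop
      simpa using this.mono_left nhdsWithin_le_nhds
    obtain ⟨ε, h1, h2⟩ := ((hl.eventually (lt_mem_nhds ha)).and
      (Ioo_mem_nhdsGT (zero_lt_one' ℝ))).exists
    filter_upwards [main ε h2.1 h2.2] with y hy
    exact h1.trans_le hy.2
  · intro a ha
    have hl : Tendsto (fun ε : ℝ ↦ Real.exp (2 * ε) * ((1 + ε) / (1 - ε))) (𝓝[>] 0) (𝓝 1) := by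
      have : ContinuousAt (fun ε : ℝ ↦ Real.exp (2 * ε) * ((1 + ε) / (1 - ε))) 0 := by
        refine ContinuousAt.mul (by fun_prop) (ContinuousAt.div (by fun_prop) (by fun_prop) ?_)
        norm_num
      simpa using this.tendsto.mono_left nhdsWithin_le_nhds
    obtain ⟨ε, h1, h2⟩ := ((hl.eventually (gt_mem_nhds ha)).and
      (Ioo_mem_nhdsGT (zero_lt_one' ℝ))).exists
    filter_upwards [main ε h2.1 h2.2] with y hy
    exact hy.1.trans_lt h1

end Tauberian

/-! ### Lattice points in dilated sets, with an error term from the boundary. -/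

section LatticeCount

open MeasureTheory Asymptotics Module
open scoped Pointwise

/-- The points within distance `ε` of which membership in `D` changes. -/
def boundaryLayer {E : Type*} [NormedAddCommGroup E] (ε : ℝ) (D : Set E) : Set E :=
  {x | ∃ y, ‖y - x‖ ≤ ε ∧ ¬(x ∈ D ↔ y ∈ D)}

variable {E : Type*} [NormedAddCommGroup E] [NormedSpace ℝ E]

theorem boundaryLayer_smul {t : ℝ} (ht : 0 < t) (ε : ℝ) (D : Set E) :
    boundaryLayer ε (t • D) = t • boundaryLayer (ε / t) D := by
  ext x
  rw [Set.mem_smul_set_iff_inv_smul_mem₀ ht.ne']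
  simp only [boundaryLayer, Set.mem_ofPred_eq, Set.mem_smul_set_iff_inv_smul_mem₀ ht.ne']
  constructor
  · rintro ⟨y, hy, h⟩
    refine ⟨t⁻¹ • y, ?_, h⟩
    rw [← smul_sub, norm_smul, Real.norm_of_nonneg (by positivity), inv_mul_eq_div]
    gcongr
  · rintro ⟨y, hy, h⟩
    refine ⟨t • y, ?_, by rwa [inv_smul_smul₀ ht.ne']⟩
    have : t • y - x = t • (y - t⁻¹ • x) := by rw [smul_sub, smul_inv_smul₀ ht.ne']
    rw [this, norm_smul, Real.norm_of_nonneg ht.le]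
    rwa [le_div_iff₀' ht] at hy

variable [FiniteDimensional ℝ E] [MeasurableSpace E] [BorelSpace E]
  (μ : Measure E) [μ.IsAddHaarMeasure] (L : Submodule ℤ E) [DiscreteTopology L] [IsZLattice ℝ L]

/-- Attach to each lattice point of `D` its translate of a fundamental domain. The translates are
disjoint and their union has volume (number of points) × covolume. A point lying in exactly one of
`D` and this union is within the size of the domain of a lattice point on the other side of the
boundary of `D`. -/
theorem exists_abs_card_mul_covolume_sub_le :
    ∃ c : ℝ, 0 < c ∧ ∀ D : Set E, Bornology.IsBounded D → MeasurableSet D →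
      μ (boundaryLayer c D) ≠ ⊤ →
      |Nat.card (D ∩ L : Set E) * ZLattice.covolume L μ - μ.real D| ≤
        μ.real (boundaryLayer c D) := by
  have : ProperSpace E := FiniteDimensional.proper ℝ E
  let b₀ := Free.chooseBasis ℤ L
  let b := b₀.ofZLatticeBasis ℝ L
  have hspan : Submodule.span ℤ (Set.range b) = L := b₀.ofZLatticeBasis_span ℝ
  let F := ZSpan.fundamentalDomain b
  obtain ⟨c, hc⟩ := (ZSpan.fundamentalDomain_isBounded b).exists_norm_le
  refine ⟨max c 1, by positivity, fun D hD hDm hfin ↦ ?_⟩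
  have hS : (D ∩ L : Set E).Finite := by
    have := ZSpan.setFinite_inter b hD
    rwa [hspan] at this
  let S := hS.toFinset
  have hSL : ∀ a ∈ S, a ∈ L ∧ a ∈ D := fun a ha ↦ by
    have := hS.mem_toFinset.mp ha
    exact ⟨this.2, this.1⟩
  have hFm : MeasurableSet F := ZSpan.fundamentalDomain_measurableSet b
  let U : Set E := ⋃ a ∈ S, (fun x ↦ x - a) ⁻¹' F
  have hpm : ∀ a : E, MeasurableSet ((fun x ↦ x - a) ⁻¹' F) := fun a ↦
    hFm.preimage (measurable_id.sub_const a)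
  have hfr : ∀ a ∈ L, ∀ x, x - a ∈ F → x - a = ZSpan.fract b x := by
    intro a ha x hx
    rw [← ZSpan.fract_eq_self.mpr hx, sub_eq_add_neg, ZSpan.fract_add_ZSpan]
    rw [hspan]; exact L.neg_mem ha
  have hμU : μ.real U = Nat.card (D ∩ L : Set E) * ZLattice.covolume L μ := by
    have hpf : ∀ a ∈ S, μ ((fun x ↦ x - a) ⁻¹' F) ≠ ⊤ := by
      intro a _
      simp only [sub_eq_add_neg, measure_preimage_add_right]
      exact (ZSpan.fundamentalDomain_isBounded b).measure_lt_top.ne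
    rw [measureReal_biUnion_finset (h := hpf)]
    · rw [ZLattice.covolume_eq_measure_fundamentalDomain L μ (ZLattice.isAddFundamentalDomain b₀ μ)]
      have : ∀ a ∈ S, μ.real ((fun x ↦ x - a) ⁻¹' F) = μ.real F := by
        intro a _
        simp only [measureReal_def, sub_eq_add_neg, measure_preimage_add_right]
      rw [Finset.sum_congr rfl this, Finset.sum_const, nsmul_eq_mul]
      congr 2
      exact (Nat.card_eq_card_finite_toFinset hS).symm
    · intro a ha a' ha' hne
      refine Set.disjoint_left.mpr fun x hx hx' ↦ hne ?_
      have h1 := hfr a (hSL a ha).1 x hx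
      have h2 := hfr a' (hSL a' ha').1 x hx'
      exact sub_right_injective (h1.trans h2.symm)
    · exact fun a _ ↦ hpm a
  have hUfin : μ U ≠ ⊤ := by
    refine ((measure_biUnion_finset_le S _).trans_lt (ENNReal.sum_lt_top.mpr fun a _ ↦ ?_)).ne
    simp only [sub_eq_add_neg, measure_preimage_add_right]
    exact (ZSpan.fundamentalDomain_isBounded b).measure_lt_top
  have hUm : MeasurableSet U := Finset.measurableSet_biUnion _ fun a _ ↦ hpm a
  rw [← hμU]
  refine (abs_measureReal_sub_le_measureReal_symmDiff' hUm.nullMeasurableSet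
    hDm.nullMeasurableSet hUfin hD.measure_lt_top.ne).trans ?_
  refine measureReal_mono ?_ hfin
  rintro x (⟨hxU, hxD⟩ | ⟨hxD, hxU⟩)
  · simp only [U, Set.mem_iUnion] at hxU
    obtain ⟨a, ha, hxa⟩ := hxU
    refine ⟨a, ?_, fun h ↦ hxD (h.mpr (hSL a ha).2)⟩
    rw [norm_sub_rev]
    exact (hc _ hxa).trans (le_max_left _ _)
  · refine ⟨ZSpan.floor b x, ?_, fun h ↦ hxU ?_⟩
    · rw [norm_sub_rev]
      exact (hc _ (ZSpan.fract_mem_fundamentalDomain b x)).trans (le_max_left _ _)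
    · simp only [U, Set.mem_iUnion]
      refine ⟨ZSpan.floor b x, hS.mem_toFinset.mpr ⟨h.mp hxD, ?_⟩,
        ZSpan.fract_mem_fundamentalDomain b x⟩
      exact hspan.le (ZSpan.floor b x).2

/-- The layer of width c around t • D is t times the layer of width c / t around `D`, so a volume
bound of order ε^β saves a factor t^(-β). -/
theorem card_smul_inter_sub_isBigO {D : Set E} (hD : Bornology.IsBounded D)
    (hDm : MeasurableSet D) {C β ε₀ : ℝ} (hε₀ : 0 < ε₀)
    (hlayer : ∀ ε, 0 < ε → ε ≤ ε₀ → μ (boundaryLayer ε D) ≤ ENNReal.ofReal (C * ε ^ β)) :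
    (fun t : ℝ ↦ (Nat.card ((t • D) ∩ L : Set E) : ℝ) -
      μ.real D / ZLattice.covolume L μ * t ^ finrank ℝ E) =O[atTop]
      fun t ↦ t ^ finrank ℝ E * t ^ (-β) := by
  obtain ⟨c, hc, h⟩ := exists_abs_card_mul_covolume_sub_le μ L
  have hV := ZLattice.covolume_pos L μ
  refine IsBigO.of_bound ((ZLattice.covolume L μ)⁻¹ * |C| * c ^ β) ?_
  filter_upwards [eventually_ge_atTop (c / ε₀), eventually_gt_atTop 0] with t ht ht0
  have hct : c / t ≤ ε₀ := by
    rw [div_le_iff₀ ht0]; rwa [div_le_iff₀' hε₀] at ht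
  have h1 := hlayer (c / t) (by positivity) hct
  have h2 : μ (boundaryLayer c (t • D)) ≤ ENNReal.ofReal (t ^ finrank ℝ E * (C * (c / t) ^ β)) := by
    rw [boundaryLayer_smul ht0, Measure.addHaar_smul, abs_of_pos (by positivity),
      ENNReal.ofReal_mul (by positivity)]
    gcongr
  have h3 := h (t • D) (hD.smul₀ t) (hDm.const_smul₀ t) (h2.trans_lt ENNReal.ofReal_lt_top).ne
  have h4 : μ.real (boundaryLayer c (t • D)) ≤ t ^ finrank ℝ E * (|C| * (c / t) ^ β) := by
    refine ENNReal.toReal_le_of_le_ofReal (by positivity) (h2.trans (ENNReal.ofReal_le_ofReal ?_))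
    gcongr
    exact le_abs_self C
  have h5 : μ.real (t • D) = t ^ finrank ℝ E * μ.real D := by
    rw [measureReal_def, Measure.addHaar_smul, abs_of_pos (by positivity), ENNReal.toReal_mul,
      ENNReal.toReal_ofReal (by positivity), measureReal_def]
  rw [h5] at h3
  have h6 : (Nat.card ((t • D) ∩ L : Set E) : ℝ) -
      μ.real D / ZLattice.covolume L μ * t ^ finrank ℝ E = (ZLattice.covolume L μ)⁻¹ *
      (Nat.card ((t • D) ∩ L : Set E) * ZLattice.covolume L μ - t ^ finrank ℝ E * μ.real D) := by
    field_simp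
  rw [h6, norm_mul, Real.norm_of_nonneg (inv_pos.mpr hV).le, Real.norm_eq_abs,
    Real.norm_of_nonneg (by positivity)]
  calc _ ≤ (ZLattice.covolume L μ)⁻¹ * (t ^ finrank ℝ E * (|C| * (c / t) ^ β)) := by
        gcongr; exact h3.trans h4
    _ = _ := by
        rw [Real.div_rpow hc.le ht0.le, Real.rpow_neg ht0.le]; ring

end LatticeCount

/-! ### Volume of the boundary layer of the fundamental domain for the units. -/

section MixedSpaceVolume

open MeasureTheory Module NumberField.InfinitePlace NumberField.mixedEmbedding
  NumberField.Units NumberField.Units.dirichletUnitTheorem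
open scoped Classical

variable {K : Type*} [Field K] [NumberField K]

theorem volume_image_mixedSpaceOfRealSpace_mul {v : realSpace K} (hv : ∀ w, 0 < v w)
    (S : Set (mixedSpace K)) :
    volume ((fun x ↦ mixedSpaceOfRealSpace v * x) '' S) =
      ENNReal.ofReal (∏ w, v w ^ mult w) * volume S := by
  let f₁ : ({w : InfinitePlace K // IsReal w} → ℝ) →ₗ[ℝ] _ :=
    LinearMap.pi fun w ↦ (v w.1 • LinearMap.id (R := ℝ) (M := ℝ)).comp (LinearMap.proj w)
  let f₂ : ({w : InfinitePlace K // IsComplex w} → ℂ) →ₗ[ℝ] _ :=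
    LinearMap.pi fun w ↦ (v w.1 • LinearMap.id (R := ℝ) (M := ℂ)).comp (LinearMap.proj w)
  have hf : (fun x : mixedSpace K ↦ mixedSpaceOfRealSpace v * x) = f₁.prodMap f₂ := by
    ext x w
    · simp [f₁, mixedSpaceOfRealSpace_apply]
    · simp [f₂, mixedSpaceOfRealSpace_apply]
  have hdet : LinearMap.det (f₁.prodMap f₂) = ∏ w, v w ^ mult w := by
    rw [LinearMap.det_prodMap, LinearMap.det_pi, LinearMap.det_pi,
      prod_eq_prod_mul_prod]
    simp [mult_isReal, mult_isComplex, LinearMap.det_smul]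
  rw [hf, Measure.addHaar_image_linearMap, hdet,
    abs_of_nonneg (Finset.prod_nonneg fun w _ ↦ pow_nonneg (hv w).le _)]

/-- The logarithms of the absolute values of `x` at the infinite places. -/
noncomputable def logPlaces (x : mixedSpace K) : realSpace K :=
  fun w ↦ Real.log (normAtPlace w x)

theorem measurable_logPlaces : Measurable (logPlaces (K := K)) :=
  measurable_pi_iff.mpr fun w ↦ (continuous_normAtPlace w).measurable.log

theorem norm_le_iff_normAtPlace_le {x : mixedSpace K} {r : ℝ} :
    ‖x‖ ≤ r ↔ ∀ w, normAtPlace w x ≤ r := by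
  rw [norm_eq_sup'_normAtPlace]
  simp

theorem logPlaces_mul {x y : mixedSpace K} (hx : mixedEmbedding.norm x ≠ 0)
    (hy : mixedEmbedding.norm y ≠ 0) : logPlaces (x * y) = logPlaces x + logPlaces y := by
  ext w
  simp only [logPlaces, map_mul, Pi.add_apply]
  exact Real.log_mul (mixedEmbedding.norm_ne_zero_iff.mp hx w)
    (mixedEmbedding.norm_ne_zero_iff.mp hy w)

omit [NumberField K] in
theorem normAtPlace_mixedSpaceOfRealSpace_exp (l : realSpace K) (w : InfinitePlace K) :
    normAtPlace w (mixedSpaceOfRealSpace fun w ↦ Real.exp (l w)) = Real.exp (l w) :=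
  normAtPlace_mixedSpaceOfRealSpace (Real.exp_pos _).le

theorem norm_mixedSpaceOfRealSpace_exp_ne_zero (l : realSpace K) :
    mixedEmbedding.norm (mixedSpaceOfRealSpace fun w ↦ Real.exp (l w)) ≠ 0 := by
  rw [mixedEmbedding.norm_ne_zero_iff]
  intro w
  rw [normAtPlace_mixedSpaceOfRealSpace_exp]
  exact (Real.exp_pos _).ne'

omit [NumberField K] in
theorem logPlaces_mixedSpaceOfRealSpace_exp (l : realSpace K) :
    logPlaces (mixedSpaceOfRealSpace fun w ↦ Real.exp (l w)) = l := by
  ext w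
  rw [logPlaces, normAtPlace_mixedSpaceOfRealSpace_exp, Real.log_exp]

/-- Stretching the coordinate at `w` by R / δ keeps the set inside the ball of radius R and
multiplies its volume by at least R / δ. -/
theorem exists_volume_normAtPlace_le (w : InfinitePlace K) {R : ℝ} (hR : 0 < R) :
    ∃ C, 0 ≤ C ∧ ∀ δ, 0 < δ → volume {x : mixedSpace K | ‖x‖ ≤ R ∧ normAtPlace w x ≤ δ} ≤
      ENNReal.ofReal (C * δ) := by
  let V := volume.real (Metric.closedBall (0 : mixedSpace K) R)
  have hV : volume (Metric.closedBall (0 : mixedSpace K) R) = ENNReal.ofReal V :=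
    (ENNReal.ofReal_toReal Metric.isBounded_closedBall.measure_lt_top.ne).symm
  have hV0 : 0 ≤ V := measureReal_nonneg
  refine ⟨V / R, by positivity, fun δ hδ ↦ ?_⟩
  set S := {x : mixedSpace K | ‖x‖ ≤ R ∧ normAtPlace w x ≤ δ}
  by_cases hδR : R ≤ δ
  · calc volume S ≤ volume (Metric.closedBall (0 : mixedSpace K) R) :=
          measure_mono fun x hx ↦ by simpa using hx.1
      _ ≤ _ := by
          rw [hV]
          refine ENNReal.ofReal_le_ofReal ?_
          rw [div_mul_eq_mul_div, le_div_iff₀ hR]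
          gcongr
  · push Not at hδR
    let v : realSpace K := fun w' ↦ if w' = w then R / δ else 1
    have hv : ∀ w', 0 < v w' := fun w' ↦ by
      simp only [v]; split_ifs <;> positivity
    have hprod : R / δ ≤ ∏ w', v w' ^ mult w' := by
      rw [Finset.prod_eq_single w (by intro b _ hb; simp [v, hb]) (by simp)]
      simp only [v, if_true]
      exact le_self_pow₀ ((one_le_div hδ).mpr hδR.le) mult_ne_zero
    have himg : (fun x ↦ mixedSpaceOfRealSpace v * x) '' S ⊆
        Metric.closedBall (0 : mixedSpace K) R := by
      rintro _ ⟨x, hx, rfl⟩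
      rw [mem_closedBall_zero_iff, norm_le_iff_normAtPlace_le]
      intro w'
      rw [map_mul, normAtPlace_mixedSpaceOfRealSpace (hv w').le]
      by_cases h : w' = w
      · simp only [v, h, if_true]
        calc R / δ * normAtPlace w x ≤ R / δ * δ := by gcongr; exact hx.2
          _ = R := by field_simp
      · simp only [v, h, if_false, one_mul]
        exact norm_le_iff_normAtPlace_le.mp hx.1 w'
    have h1 := (volume_image_mixedSpaceOfRealSpace_mul hv S).symm.le.trans (measure_mono himg)
    have h2 : ENNReal.ofReal (R / δ) * volume S ≤ ENNReal.ofReal V :=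
      hV ▸ (mul_le_mul_left (ENNReal.ofReal_le_ofReal hprod) _).trans h1
    have hRδ : 0 < R / δ := by positivity
    rw [mul_comm, ← ENNReal.le_div_iff_mul_le (by simp [hRδ]) (by simp),
      ← ENNReal.ofReal_div_of_pos hRδ] at h2
    convert h2 using 2
    field_simp

/-- Multiplication by exp(t l) shifts Φ ∘ `logPlaces` by t and, by `hl0`, does not shrink volume for
t ≥ 0. About 1 / (3η) such shifts, by multiples of 3η, give disjoint sets in one fixed ball, so the
slab has volume O(η), uniformly in `a`. -/
theorem exists_volume_logPlaces_slab_aux {Φ : realSpace K →ₗ[ℝ] ℝ} {l : realSpace K}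
    (hl : Φ l = 1) (hl0 : 0 ≤ ∑ w, mult w * l w) (R : ℝ) :
    ∃ C, 0 ≤ C ∧ ∀ a η : ℝ, 0 < η → volume {x : mixedSpace K | ‖x‖ ≤ R ∧
      mixedEmbedding.norm x ≠ 0 ∧ |Φ (logPlaces x) - a| ≤ η} ≤ ENNReal.ofReal (C * η) := by
  let R' := max R 0 * Real.exp ‖l‖
  let V := volume.real (Metric.closedBall (0 : mixedSpace K) R')
  have hV : volume (Metric.closedBall (0 : mixedSpace K) R') = ENNReal.ofReal V :=
    (ENNReal.ofReal_toReal Metric.isBounded_closedBall.measure_lt_top.ne).symm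
  have hV0 : 0 ≤ V := measureReal_nonneg
  have hRR' : R ≤ R' := (le_max_left R 0).trans
    (le_mul_of_one_le_right (le_max_right _ _) (Real.one_le_exp (norm_nonneg _)))
  refine ⟨6 * V, by positivity, fun a η hη ↦ ?_⟩
  set S := {x : mixedSpace K | ‖x‖ ≤ R ∧
      mixedEmbedding.norm x ≠ 0 ∧ |Φ (logPlaces x) - a| ≤ η}
  -- For η > 1/6 the bound 6Vη already exceeds the volume of the ball. Otherwise 1 / (6η) ≥ 1, so
  -- taking the floor of 1 / (3η) loses at most a factor 2.
  by_cases hη3 : 1 / 6 < η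
  · calc volume S ≤ volume (Metric.closedBall (0 : mixedSpace K) R') :=
          measure_mono fun x hx ↦ by simpa using hx.1.trans hRR'
      _ ≤ _ := by
          rw [hV]
          refine ENNReal.ofReal_le_ofReal ?_
          nlinarith
  push Not at hη3
  have hSm : MeasurableSet S := by
    have hΦ : Measurable Φ := (LinearMap.continuous_of_finiteDimensional Φ).measurable
    have h1 : MeasurableSet {x : mixedSpace K | ‖x‖ ≤ R} :=
      measurableSet_le measurable_norm measurable_const
    have h2 : MeasurableSet {x : mixedSpace K | mixedEmbedding.norm x ≠ 0} :=
      (measurableSet_eq_fun (mixedEmbedding.continuous_norm K).measurable measurable_const).compl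
    have h3 : MeasurableSet {x : mixedSpace K | |Φ (logPlaces x) - a| ≤ η} :=
      measurableSet_le (f := fun x ↦ |Φ (logPlaces x) - a|)
        ((hΦ.comp measurable_logPlaces).sub_const a).abs measurable_const
    exact h1.inter (h2.inter h3)
  let e : ℝ → realSpace K := fun t w ↦ Real.exp (t * l w)
  have he : ∀ t w, 0 < e t w := fun t w ↦ Real.exp_pos _
  let m := ⌊1 / (3 * η)⌋₊
  have hm1 : (m : ℝ) ≤ 1 / (3 * η) := Nat.floor_le (by positivity)
  have hm2 : 1 / (6 * η) ≤ m := by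
    have h1 : 1 / (3 * η) < m + 1 := Nat.lt_floor_add_one _
    have h2 : 1 ≤ 1 / (6 * η) := by rw [le_div_iff₀ (by positivity)]; linarith
    have h3 : 1 / (3 * η) = 2 * (1 / (6 * η)) := by field_simp; norm_num
    linarith
  let T : ℕ → Set (mixedSpace K) := fun j ↦
    (fun x ↦ mixedSpaceOfRealSpace (e (3 * η * j)) * x) '' S
  have hTm : ∀ j, MeasurableSet (T j) := by
    intro j
    have hinv : T j = (fun x ↦ mixedSpaceOfRealSpace (e (-(3 * η * j))) * x) ⁻¹' S := by
      have hcancel : ∀ t, mixedSpaceOfRealSpace (e (-t)) * mixedSpaceOfRealSpace (e t) = 1 := by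
        intro t
        simp only [mixedSpaceOfRealSpace_apply, e]
        ext w
        · simp [← Real.exp_add]
        · simp [← Complex.exp_add]
      ext x
      constructor
      · rintro ⟨y, hy, rfl⟩
        simpa [← mul_assoc, hcancel] using hy
      · intro hx
        refine ⟨_, hx, ?_⟩
        have := hcancel (-(3 * η * j))
        rw [neg_neg] at this
        simp [← mul_assoc, this]
    rw [hinv]
    exact hSm.preimage (continuous_const.mul continuous_id).measurable
  have hTΦ : ∀ j, ∀ x ∈ T j, |Φ (logPlaces x) - (a + 3 * η * j)| ≤ η := by
    rintro j _ ⟨x, hx, rfl⟩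
    have h1 : logPlaces (mixedSpaceOfRealSpace (e (3 * η * j)) * x) =
        (3 * η * j) • l + logPlaces x := by
      rw [logPlaces_mul (norm_mixedSpaceOfRealSpace_exp_ne_zero (fun w ↦ 3 * η * j * l w)) hx.2.1]
      congr 1
      exact logPlaces_mixedSpaceOfRealSpace_exp (fun w ↦ 3 * η * j * l w)
    have h2 : Φ (logPlaces (mixedSpaceOfRealSpace (e (3 * η * j)) * x)) - (a + 3 * η * j) =
        Φ (logPlaces x) - a := by
      rw [h1, map_add, map_smul, hl]; simp; ring
    simp only [h2]
    exact hx.2.2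
  have hdisj : (↑(Finset.range m) : Set ℕ).PairwiseDisjoint T := by
    intro i _ j _ hij
    refine Set.disjoint_left.mpr fun x hxi hxj ↦ ?_
    have h1 := abs_le.mp (hTΦ i x hxi)
    have h2 := abs_le.mp (hTΦ j x hxj)
    rcases lt_or_gt_of_ne hij with h | h
    · have : (i : ℝ) + 1 ≤ j := by exact_mod_cast h
      nlinarith
    · have : (j : ℝ) + 1 ≤ i := by exact_mod_cast h
      nlinarith
  have hsub : (⋃ j ∈ Finset.range m, T j) ⊆ Metric.closedBall (0 : mixedSpace K) R' := by
    intro x hx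
    simp only [Set.mem_iUnion, Finset.mem_range] at hx
    obtain ⟨j, hj, y, hy, rfl⟩ := hx
    rw [mem_closedBall_zero_iff, norm_le_iff_normAtPlace_le]
    intro w
    rw [map_mul, normAtPlace_mixedSpaceOfRealSpace (he _ w).le, mul_comm]
    have h1 : normAtPlace w y ≤ max R 0 :=
      (norm_le_iff_normAtPlace_le.mp hy.1 w).trans (le_max_left _ _)
    have h2 : 3 * η * j ≤ 1 := by
      have : (j : ℝ) ≤ m := by exact_mod_cast hj.le
      have h3 := this.trans hm1
      rwa [le_div_iff₀ (by positivity), mul_comm] at h3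
    have h3 : e (3 * η * j) w ≤ Real.exp ‖l‖ := by
      refine Real.exp_le_exp.mpr ?_
      calc 3 * η * j * l w ≤ 3 * η * j * ‖l‖ := by
            gcongr
            exact (le_abs_self _).trans (norm_le_pi_norm l w)
        _ ≤ 1 * ‖l‖ := by gcongr
        _ = ‖l‖ := one_mul _
    exact mul_le_mul h1 h3 (he _ w).le (le_max_right _ _)
  have hvol : ∀ j, volume S ≤ volume (T j) := by
    intro j
    have h1 := volume_image_mixedSpaceOfRealSpace_mul (he (3 * η * j)) S
    have h2 : 1 ≤ ∏ w, e (3 * η * j) w ^ mult w := by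
      simp only [e, ← Real.exp_nat_mul]
      rw [← Real.exp_sum]
      refine Real.one_le_exp ?_
      have : ∑ w, (mult w : ℝ) * (3 * η * j * l w) = 3 * η * j * ∑ w, mult w * l w := by
        rw [Finset.mul_sum]; exact Finset.sum_congr rfl fun w _ ↦ by ring
      rw [this]
      positivity
    change _ ≤ volume ((fun x ↦ mixedSpaceOfRealSpace (e (3 * η * j)) * x) '' S)
    rw [h1]
    exact le_mul_of_one_le_left bot_le (by simpa using ENNReal.ofReal_le_ofReal h2)
  have h1 : (m : ENNReal) * volume S ≤ ENNReal.ofReal V := by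
    rw [← hV]
    refine le_trans ?_ (measure_mono hsub)
    rw [measure_biUnion_finset hdisj fun j _ ↦ hTm j]
    calc (m : ENNReal) * volume S = ∑ j ∈ Finset.range m, volume S := by simp
      _ ≤ _ := Finset.sum_le_sum fun j _ ↦ hvol j
  have h2 : ENNReal.ofReal (1 / (6 * η)) * volume S ≤ ENNReal.ofReal V := by
    refine le_trans ?_ h1
    gcongr
    rw [← ENNReal.ofReal_natCast]
    exact ENNReal.ofReal_le_ofReal hm2
  have hη6 : 0 < 1 / (6 * η) := by positivity
  rw [mul_comm, ← ENNReal.le_div_iff_mul_le (by simp [hη]) (by simp),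
    ← ENNReal.ofReal_div_of_pos hη6] at h2
  convert h2 using 2
  field_simp

theorem exists_volume_logPlaces_slab {Φ : realSpace K →ₗ[ℝ] ℝ} (hΦ : Φ ≠ 0) (R : ℝ) :
    ∃ C, 0 ≤ C ∧ ∀ a η : ℝ, 0 < η → volume {x : mixedSpace K | ‖x‖ ≤ R ∧
      mixedEmbedding.norm x ≠ 0 ∧ |Φ (logPlaces x) - a| ≤ η} ≤ ENNReal.ofReal (C * η) := by
  obtain ⟨l, hl⟩ := LinearMap.surjective hΦ 1
  by_cases h : 0 ≤ ∑ w, mult w * l w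
  · exact exists_volume_logPlaces_slab_aux hl h R
  · obtain ⟨C, hC, hS⟩ := exists_volume_logPlaces_slab_aux (Φ := -Φ) (l := -l) (by simpa using hl)
      (by simp only [Pi.neg_apply, mul_neg, Finset.sum_neg_distrib]; linarith) R
    refine ⟨C, hC, fun a η hη ↦ ?_⟩
    have h1 : ∀ x : mixedSpace K,
        |(-Φ) (logPlaces x) - -a| = |Φ (logPlaces x) - a| := fun x ↦ by
      rw [LinearMap.neg_apply, neg_sub_neg, abs_sub_comm]
    simpa only [h1] using hS (-a) η hη

/-- In logarithmic coordinates `D` is cut out by linear conditions that change only at the values 0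
and 1. A point of the ε-layer either has some absolute value O(√ε), or has all of them above √ε. In
the second case a move of size ε changes the logarithms by at most √ε and the point lies in a slab
of width O(√ε) around 0 or 1. This is the source of the exponent 1/2. -/
theorem exists_volume_boundaryLayer_le {ι : Type*} [Fintype ι] {Φ : ι → realSpace K →ₗ[ℝ] ℝ}
    (hΦ : ∀ i, Φ i ≠ 0) {I : ι → Set ℝ}
    (hI : ∀ i, ∀ s t, ¬(s ∈ I i ↔ t ∈ I i) → |s - 0| ≤ |t - s| ∨ |s - 1| ≤ |t - s|)
    {D : Set (mixedSpace K)} (hD : Bornology.IsBounded D)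
    (hDI : ∀ x, mixedEmbedding.norm x ≠ 0 → (x ∈ D ↔ ∀ i, Φ i (logPlaces x) ∈ I i)) :
    ∃ C ε₀ : ℝ, 0 < ε₀ ∧ ∀ ε, 0 < ε → ε ≤ ε₀ →
      volume (boundaryLayer ε D) ≤ ENNReal.ofReal (C * ε ^ (1 / 2 : ℝ)) := by
  obtain ⟨R₀, hR₀⟩ := hD.exists_norm_le
  let R := max R₀ 0 + 1
  have hR : 0 < R := by positivity
  choose C₁ hC₁ hT using fun w : InfinitePlace K ↦ exists_volume_normAtPlace_le w hR
  choose C₂ hC₂ hS using fun i ↦ exists_volume_logPlaces_slab (hΦ i) R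
  have hbd : ∀ i, ∃ c, 0 < c ∧ ∀ l, |Φ i l| ≤ c * ‖l‖ := fun i ↦ by
    obtain ⟨c, hc, h⟩ := (LinearMap.toContinuousLinearMap (Φ i)).bound
    exact ⟨c, hc, fun l ↦ by simpa using h l⟩
  choose c hc hcΦ using hbd
  refine ⟨∑ w, C₁ w * 2 + ∑ i, (C₂ i * c i + C₂ i * c i), 1, one_pos, fun ε hε hε1 ↦ ?_⟩
  set r := ε ^ (1 / 2 : ℝ) with hr
  have hr0 : 0 < r := by positivity
  have hr2 : ε = r * r := by
    rw [hr, ← Real.rpow_add hε]; norm_num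
  have hr1 : r ≤ 1 := Real.rpow_le_one hε.le hε1 (by norm_num)
  have hsub : boundaryLayer ε D ⊆
      (⋃ w : InfinitePlace K, {x | ‖x‖ ≤ R ∧ normAtPlace w x ≤ 2 * r}) ∪
      ⋃ i, ({x | ‖x‖ ≤ R ∧ mixedEmbedding.norm x ≠ 0 ∧ |Φ i (logPlaces x) - 0| ≤ c i * r} ∪
        {x | ‖x‖ ≤ R ∧ mixedEmbedding.norm x ≠ 0 ∧ |Φ i (logPlaces x) - 1| ≤ c i * r}) := by
    rintro x ⟨y, hxy, hne⟩
    have hxR : ‖x‖ ≤ R := by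
      by_cases hx : x ∈ D
      · exact (hR₀ x hx).trans ((le_max_left _ 0).trans (by simp [R]))
      · have hy : y ∈ D := by tauto
        calc ‖x‖ = ‖y - (y - x)‖ := by rw [sub_sub_cancel]
          _ ≤ ‖y‖ + ‖y - x‖ := norm_sub_le _ _
          _ ≤ max R₀ 0 + 1 := add_le_add ((hR₀ y hy).trans (le_max_left _ _)) (hxy.trans hε1)
    -- The threshold is 2r rather than r so that the nearby point `y` still has all absolute values
    -- at least 2r - r² ≥ r.
    by_cases hsmall : ∃ w, normAtPlace w x ≤ 2 * r
    · obtain ⟨w, hw⟩ := hsmall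
      exact Or.inl (Set.mem_iUnion.mpr ⟨w, hxR, hw⟩)
    push Not at hsmall
    right
    have hdiff : ∀ w, |normAtPlace w y - normAtPlace w x| ≤ r * r := by
      intro w
      have h0 : normAtPlace w (y - x) ≤ r * r :=
        hr2 ▸ norm_le_iff_normAtPlace_le.mp hxy w
      have h1 := normAtPlace_add_le w (y - x) x
      have h2 := normAtPlace_add_le w (x - y) y
      rw [sub_add_cancel] at h1 h2
      have h3 : normAtPlace w (x - y) = normAtPlace w (y - x) := by
        rw [← normAtPlace_neg, neg_sub]
      rw [abs_le]
      constructor <;> linarith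
    have hxpos : ∀ w, r < normAtPlace w x := fun w ↦ by linarith [hsmall w]
    have hypos : ∀ w, r ≤ normAtPlace w y := fun w ↦ by
      have h1 := (abs_le.mp (hdiff w)).1
      nlinarith [hsmall w]
    have hx0 : mixedEmbedding.norm x ≠ 0 :=
      mixedEmbedding.norm_ne_zero_iff.mpr fun w ↦ (hr0.trans (hxpos w)).ne'
    have hy0 : mixedEmbedding.norm y ≠ 0 :=
      mixedEmbedding.norm_ne_zero_iff.mpr fun w ↦ (hr0.trans_le (hypos w)).ne'
    have hlog : ∀ a b : ℝ, r ≤ a → r ≤ b → |a - b| ≤ r * r → Real.log a - Real.log b ≤ r := by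
      intro a b ha hb hab
      have ha0 := hr0.trans_le ha
      have hb0 := hr0.trans_le hb
      rw [← Real.log_div ha0.ne' hb0.ne']
      refine (Real.log_le_sub_one_of_pos (by positivity)).trans ?_
      rw [div_sub_one hb0.ne', div_le_iff₀ hb0]
      nlinarith [(abs_le.mp hab).2]
    have hL : ‖logPlaces y - logPlaces x‖ ≤ r := by
      rw [pi_norm_le_iff_of_nonneg hr0.le]
      intro w
      rw [Real.norm_eq_abs, abs_le]
      have h1 := hlog _ _ (hypos w) (hxpos w).le (hdiff w)
      have h2 := hlog _ _ (hxpos w).le (hypos w) (by rw [abs_sub_comm]; exact hdiff w)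
      simp only [Pi.sub_apply, logPlaces]
      constructor <;> linarith
    rw [hDI x hx0, hDI y hy0] at hne
    obtain ⟨i, hi⟩ : ∃ i, ¬(Φ i (logPlaces x) ∈ I i ↔ Φ i (logPlaces y) ∈ I i) := by
      by_contra! h
      exact hne (forall_congr' h)
    have hle : |Φ i (logPlaces y) - Φ i (logPlaces x)| ≤ c i * r := by
      rw [← map_sub]
      exact (hcΦ i _).trans (mul_le_mul_of_nonneg_left hL (hc i).le)
    refine Set.mem_iUnion.mpr ⟨i, ?_⟩
    rcases hI i _ _ hi with h | h
    · exact Or.inl ⟨hxR, hx0, h.trans hle⟩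
    · exact Or.inr ⟨hxR, hx0, h.trans hle⟩
  calc volume (boundaryLayer ε D) ≤ _ := measure_mono hsub
    _ ≤ ∑ w, ENNReal.ofReal (C₁ w * (2 * r)) +
        ∑ i, (ENNReal.ofReal (C₂ i * (c i * r)) + ENNReal.ofReal (C₂ i * (c i * r))) := by
        refine (measure_union_le _ _).trans (add_le_add ?_ ?_)
        · refine (measure_iUnion_fintype_le _ _).trans (Finset.sum_le_sum fun w _ ↦ ?_)
          exact hT w _ (by positivity)
        · refine (measure_iUnion_fintype_le _ _).trans (Finset.sum_le_sum fun i _ ↦ ?_)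
          have := mul_pos (hc i) hr0
          exact (measure_union_le _ _).trans (add_le_add (hS i 0 _ this) (hS i 1 _ this))
    _ = _ := by
        have h1 : ∀ w, 0 ≤ C₁ w * (2 * r) := fun w ↦ mul_nonneg (hC₁ w) (by positivity)
        have h2 : ∀ i, 0 ≤ C₂ i * (c i * r) := fun i ↦
          mul_nonneg (hC₂ i) (mul_pos (hc i) hr0).le
        simp_rw [← ENNReal.ofReal_add (h2 _) (h2 _)]
        rw [← ENNReal.ofReal_sum_of_nonneg fun w _ ↦ h1 w,
          ← ENNReal.ofReal_sum_of_nonneg fun i _ ↦ add_nonneg (h2 i) (h2 i),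
          ← ENNReal.ofReal_add (Finset.sum_nonneg fun w _ ↦ h1 w)
            (Finset.sum_nonneg fun i _ ↦ add_nonneg (h2 i) (h2 i))]
        congr 1
        rw [add_mul, Finset.sum_mul, Finset.sum_mul]
        congr 1
        · exact Finset.sum_congr rfl fun w _ ↦ by ring
        · exact Finset.sum_congr rfl fun i _ ↦ by ring

/-- `logMap` in terms of the logarithms of the absolute values. -/
noncomputable def logPlacesToLogSpace : realSpace K →ₗ[ℝ] logSpace K where
  toFun l w := mult w.1 * (l w.1 - (∑ w', mult w' * l w') * (finrank ℚ K : ℝ)⁻¹)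
  map_add' _ _ := by
    ext w; simp only [Pi.add_apply, mul_add, Finset.sum_add_distrib]; ring
  map_smul' a l := by
    ext w
    have : ∑ w', (mult w' : ℝ) * (a * l w') = a * ∑ w', mult w' * l w' := by
      rw [Finset.mul_sum]; exact Finset.sum_congr rfl fun _ _ ↦ by ring
    simp only [Pi.smul_apply, smul_eq_mul, RingHom.id_apply, this]; ring

theorem log_norm_eq_sum {x : mixedSpace K} (hx : mixedEmbedding.norm x ≠ 0) :
    Real.log (mixedEmbedding.norm x) = ∑ w, mult w * logPlaces x w := by
  rw [mixedEmbedding.norm_apply, Real.log_prod fun w _ ↦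
    pow_ne_zero _ (mixedEmbedding.norm_ne_zero_iff.mp hx w)]
  simp [logPlaces, Real.log_pow]

theorem logMap_eq_logPlacesToLogSpace {x : mixedSpace K} (hx : mixedEmbedding.norm x ≠ 0) :
    logMap x = logPlacesToLogSpace (logPlaces x) := by
  ext w
  rw [logMap_apply, log_norm_eq_sum hx]
  rfl

/-- The conditions are log norm ≤ 0 and, for each fundamental unit, a coordinate of `logMap` in [0,
1). The functionals are nonzero: the first takes the value [K:ℚ] at the constant vector 1, and the
i-th coordinate takes the value 1 at the i-th fundamental unit. -/
theorem volume_boundaryLayer_normLeOne_le :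
    ∃ C ε₀ : ℝ, 0 < ε₀ ∧ ∀ ε, 0 < ε → ε ≤ ε₀ →
      volume (boundaryLayer ε (fundamentalCone.normLeOne K)) ≤
        ENNReal.ofReal (C * ε ^ (1 / 2 : ℝ)) := by
  let B := (basisUnitLattice K).ofZLatticeBasis ℝ (unitLattice K)
  let Φ : Option (Fin (rank K)) → realSpace K →ₗ[ℝ] ℝ := fun i ↦ i.elim
    (∑ w, (mult w : ℝ) • LinearMap.proj w) fun i ↦ (B.coord i).comp logPlacesToLogSpace
  let I : Option (Fin (rank K)) → Set ℝ := fun i ↦ i.elim (Set.Iic 0) fun _ ↦ Set.Ico 0 1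
  refine exists_volume_boundaryLayer_le (Φ := Φ) (I := I) ?_ ?_
    (fundamentalCone.isBounded_normLeOne K) ?_
  · rintro (_ | i) h
    · have h1 := LinearMap.congr_fun h fun _ ↦ 1
      simp only [Φ, Option.elim, LinearMap.sum_apply, LinearMap.smul_apply, LinearMap.proj_apply,
        smul_eq_mul, mul_one, LinearMap.zero_apply] at h1
      rw [← Nat.cast_sum, sum_mult_eq] at h1
      exact (finrank_pos (R := ℚ) (M := K)).ne' (by exact_mod_cast h1)
    · have h1 := LinearMap.congr_fun h (logPlaces (mixedEmbedding K (fundSystem K i)))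
      have h2 : mixedEmbedding.norm (mixedEmbedding K (fundSystem K i : K)) ≠ 0 := by
        rw [norm_unit]; norm_num
      simp only [Φ, Option.elim, LinearMap.comp_apply, LinearMap.zero_apply] at h1
      rw [← logMap_eq_logPlacesToLogSpace h2, logMap_eq_logEmbedding, logEmbedding_fundSystem] at h1
      have h3 : ((basisUnitLattice K i : unitLattice K) : logSpace K) = B i :=
        ((basisUnitLattice K).ofZLatticeBasis_apply ℝ (unitLattice K) i).symm
      rw [h3, Basis.coord_apply, Basis.repr_self, Finsupp.single_eq_same] at h1
      exact one_ne_zero h1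
  · rintro (_ | i) s t h
    · simp only [I, Option.elim, Set.mem_Iic] at h
      left
      rw [sub_zero]
      rcases le_or_gt s 0 with hs | hs <;> rcases le_or_gt t 0 with ht | ht
      · exact absurd (iff_of_true hs ht) h
      · rw [abs_of_nonpos hs, abs_of_nonneg (by linarith)]; linarith
      · rw [abs_of_pos hs, abs_of_nonpos (by linarith)]; linarith
      · exact absurd (iff_of_false (not_le.mpr hs) (not_le.mpr ht)) h
    · simp only [I, Option.elim, Set.mem_Ico] at h
      by_contra! hcon
      have h1 := hcon.1
      have h2 := hcon.2
      rw [sub_zero] at h1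
      apply h
      rcases le_or_gt t s with hts | hts
      · rw [abs_of_nonpos (by linarith : t - s ≤ 0)] at h1 h2
        rcases abs_cases s with h3 | h3 <;> rcases abs_cases (s - 1) with h4 | h4 <;>
          constructor <;> rintro ⟨h5, h6⟩ <;> constructor <;> linarith
      · rw [abs_of_nonneg (by linarith : 0 ≤ t - s)] at h1 h2
        rcases abs_cases s with h3 | h3 <;> rcases abs_cases (s - 1) with h4 | h4 <;>
          constructor <;> rintro ⟨h5, h6⟩ <;> constructor <;> linarith
  · intro x hx
    have hxp : 0 < mixedEmbedding.norm x :=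
      lt_of_le_of_ne (mixedEmbedding.norm_nonneg _) hx.symm
    have h1 : Φ none (logPlaces x) = Real.log (mixedEmbedding.norm x) := by
      rw [log_norm_eq_sum hx]
      simp [Φ]
    have h2 : ∀ i, Φ (some i) (logPlaces x) = B.repr (logMap x) i := fun i ↦ by
      rw [logMap_eq_logPlacesToLogSpace hx]; rfl
    rw [Option.forall, h1]
    simp only [h2]
    rw [fundamentalCone.mem_normLeOne, fundamentalCone]
    simp only [Set.mem_sdiff, Set.mem_preimage, ZSpan.mem_fundamentalDomain, Set.mem_ofPred_eq, hx,
      not_false_eq_true, and_true, I, Option.elim, Set.mem_Iic]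
    rw [Real.log_nonpos_iff hxp.le, and_comm]

end MixedSpaceVolume

/-! ### Counting ideals by norm with a power-saving error. -/

section IdealCount

open Ideal NumberField.InfinitePlace NumberField.mixedEmbedding Asymptotics MeasureTheory Module
  NumberField.mixedEmbedding.fundamentalCone NumberField.Units
open scoped nonZeroDivisors Pointwise Classical

variable {K : Type*} [Field K] [NumberField K]

/-- Multiplication by `J`, a representative of the inverse class, makes the ideals of the class
principal and divisible by `J`. -/
theorem card_absNorm_le_and_mk0_eq {C : ClassGroup (𝓞 K)} {J : (Ideal (𝓞 K))⁰}
    (hJ : ClassGroup.mk0 J = C⁻¹) (s : ℝ) :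
    Nat.card {I : (Ideal (𝓞 K))⁰ // absNorm (I : Ideal (𝓞 K)) ≤ s ∧ ClassGroup.mk0 I = C} =
      Nat.card {I : (Ideal (𝓞 K))⁰ // (J : Ideal (𝓞 K)) ∣ I ∧
        Submodule.IsPrincipal (I : Ideal (𝓞 K)) ∧
        absNorm (I : Ideal (𝓞 K)) ≤ s * absNorm (J : Ideal (𝓞 K))} := by
  simp_rw [← nonZeroDivisors_dvd_iff_dvd_coe]
  refine Nat.card_congr ?_
  refine ((Equiv.dvd J).subtypeEquiv fun I ↦ ?_).trans
    (Equiv.subtypeSubtypeEquivSubtypeInter (fun I : (Ideal (𝓞 K))⁰ ↦ J ∣ I) _)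
  rw [← ClassGroup.mk0_eq_one_iff (SetLike.coe_mem _)]
  simp_rw [Equiv.dvd_apply, Submonoid.coe_mul, ← Submonoid.mul_def, map_mul, hJ,
    inv_mul_eq_one, Nat.cast_mul, mul_comm s, eq_comm, and_comm, and_congr_left_iff]
  exact fun _ ↦
    (mul_le_mul_iff_of_pos_left (Nat.cast_pos.mpr (absNorm_pos_of_nonZeroDivisors J))).symm

theorem card_idealSet_norm_le (J : (Ideal (𝓞 K))⁰) {t : ℝ} (ht : 0 < t) :
    Nat.card {a : idealSet K J // mixedEmbedding.norm (a : mixedSpace K) ≤ t ^ finrank ℚ K} =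
      Nat.card ((t • normLeOne K) ∩
        (mixedEmbedding.idealLattice K (FractionalIdeal.mk0 K J) : Set (mixedSpace K)) :
          Set (mixedSpace K)) := by
  refine Nat.card_congr ((Equiv.subtypeSubtypeEquivSubtypeInter (fun a ↦ a ∈ idealSet K J)
    (fun a ↦ mixedEmbedding.norm a ≤ t ^ finrank ℚ K)).trans (Equiv.subtypeEquivRight fun a ↦ ?_))
  rw [idealSet, Set.mem_inter_iff, Set.mem_inter_iff, Set.mem_smul_set_iff_inv_smul_mem₀ ht.ne',
    mem_normLeOne, smul_mem_iff_mem (inv_ne_zero ht.ne'), mixedEmbedding.norm_smul,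
    abs_of_pos (inv_pos.mpr ht),
    inv_pow, inv_mul_le_one₀ (by positivity)]
  tauto

/-- The lattice count is applied with n = [K:ℚ] and dilation t = (s N(J))^(1/n). Its error t^n ·
t^(-1/2) is then of order s^(1 - 1/(2n)). -/
theorem card_absNorm_le_and_mk0_eq_isBigO (C : ClassGroup (𝓞 K)) :
    ∃ ρ : ℝ, (fun s : ℝ ↦ (Nat.card {I : (Ideal (𝓞 K))⁰ //
        absNorm (I : Ideal (𝓞 K)) ≤ s ∧ ClassGroup.mk0 I = C} : ℝ) - ρ * s) =O[atTop]
      fun s ↦ s ^ (1 - 1 / (2 * finrank ℚ K) : ℝ) := by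
  obtain ⟨J, hJ⟩ := ClassGroup.mk0_surjective C⁻¹
  obtain ⟨c, ε₀, hε₀, hlayer⟩ := volume_boundaryLayer_normLeOne_le (K := K)
  let L := mixedEmbedding.idealLattice K (FractionalIdeal.mk0 K J)
  have hO := card_smul_inter_sub_isBigO volume L (isBounded_normLeOne K)
    (measurableSet_normLeOne K) hε₀ hlayer
  rw [mixedEmbedding.finrank] at hO
  set V := volume.real (normLeOne K) / ZLattice.covolume L
  have hn : 0 < finrank ℚ K := finrank_pos
  have hn' : (0 : ℝ) < finrank ℚ K := by exact_mod_cast hn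
  have hNJ : (0 : ℝ) < absNorm (J : Ideal (𝓞 K)) :=
    Nat.cast_pos.mpr (absNorm_pos_of_nonZeroDivisors J)
  have hw : (0 : ℝ) < torsionOrder K := Nat.cast_pos.mpr (torsionOrder_pos K)
  refine ⟨(torsionOrder K : ℝ)⁻¹ * (V * absNorm (J : Ideal (𝓞 K))), ?_⟩
  have htend : Tendsto (fun s : ℝ ↦ (s * absNorm (J : Ideal (𝓞 K))) ^ (finrank ℚ K : ℝ)⁻¹)
      atTop atTop :=
    (tendsto_rpow_atTop (by positivity)).comp (tendsto_id.atTop_mul_const hNJ)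
  have h1 := (hO.comp_tendsto htend).const_mul_left (torsionOrder K : ℝ)⁻¹
  have h2 : (fun s : ℝ ↦ s ^ (1 - 1 / (2 * finrank ℚ K) : ℝ)) =ᶠ[atTop] fun s ↦
      ((absNorm (J : Ideal (𝓞 K)) : ℝ) ^ (1 - 1 / (2 * finrank ℚ K) : ℝ))⁻¹ *
      (((s * absNorm (J : Ideal (𝓞 K))) ^ (finrank ℚ K : ℝ)⁻¹) ^ finrank ℚ K *
      ((s * absNorm (J : Ideal (𝓞 K))) ^ (finrank ℚ K : ℝ)⁻¹) ^ (-(1 / 2) : ℝ)) := by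
    filter_upwards [eventually_gt_atTop 0] with s hs
    have hsN : 0 < s * absNorm (J : Ideal (𝓞 K)) := by positivity
    rw [Real.rpow_inv_natCast_pow hsN.le hn.ne', ← Real.rpow_mul hsN.le]
    have hadd := Real.rpow_add hsN 1 ((finrank ℚ K : ℝ)⁻¹ * -(1 / 2))
    rw [Real.rpow_one] at hadd
    rw [← hadd, Real.mul_rpow hs.le hNJ.le]
    have : 1 + (finrank ℚ K : ℝ)⁻¹ * -(1 / 2) = 1 - 1 / (2 * finrank ℚ K) := by
      field_simp; ring
    rw [this, mul_comm _ ((absNorm (J : Ideal (𝓞 K)) : ℝ) ^ _), inv_mul_cancel_left₀]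
    exact (Real.rpow_pos_of_pos hNJ _).ne'
  have h3 : (fun s : ℝ ↦ ((s * absNorm (J : Ideal (𝓞 K))) ^ (finrank ℚ K : ℝ)⁻¹) ^ finrank ℚ K *
      ((s * absNorm (J : Ideal (𝓞 K))) ^ (finrank ℚ K : ℝ)⁻¹) ^ (-(1 / 2) : ℝ)) =O[atTop]
      fun s ↦ s ^ (1 - 1 / (2 * finrank ℚ K) : ℝ) := by
    refine IsBigO.trans_eventuallyEq ?_ h2.symm
    exact (isBigO_refl _ _).const_mul_right
      (inv_ne_zero (Real.rpow_pos_of_pos hNJ _).ne')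
  refine (IsBigO.trans_eventuallyEq (h1.trans h3) EventuallyEq.rfl).congr' ?_ EventuallyEq.rfl
  filter_upwards [eventually_gt_atTop 0] with s hs
  have hsN : 0 < s * absNorm (J : Ideal (𝓞 K)) := by positivity
  have hpow : ((s * absNorm (J : Ideal (𝓞 K))) ^ (finrank ℚ K : ℝ)⁻¹) ^ finrank ℚ K =
      s * absNorm (J : Ideal (𝓞 K)) := Real.rpow_inv_natCast_pow hsN.le hn.ne'
  -- Each principal ideal is counted once for each of its `torsionOrder K` generators in the
  -- fundamental cone.
  have hcard := card_isPrincipal_dvd_norm_le K J (s * absNorm (J : Ideal (𝓞 K)))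
  have hcard2 := card_idealSet_norm_le J
    (t := (s * absNorm (J : Ideal (𝓞 K))) ^ (finrank ℚ K : ℝ)⁻¹) (Real.rpow_pos_of_pos hsN _)
  rw [hpow] at hcard2
  rw [← card_absNorm_le_and_mk0_eq hJ, hcard2] at hcard
  simp only [Function.comp_apply]
  rw [← hcard, hpow]
  push_cast
  field_simp

theorem exists_card_absNorm_le_sub_isBigO (K : Type*) [Field K] [NumberField K] :
    ∃ ρ θ : ℝ, 0 < ρ ∧ 0 < θ ∧ θ < 1 ∧
      (fun s : ℝ ↦ (Nat.card {I : (Ideal (𝓞 K))⁰ // absNorm (I : Ideal (𝓞 K)) ≤ s} : ℝ) -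
        ρ * s) =O[atTop] fun s ↦ s ^ θ := by
  choose ρ hρ using card_absNorm_le_and_mk0_eq_isBigO (K := K)
  have hn' : (1 : ℝ) ≤ finrank ℚ K := by exact_mod_cast finrank_pos (R := ℚ) (M := K)
  have hθ1 : (1 - 1 / (2 * finrank ℚ K) : ℝ) < 1 := by
    have : (0 : ℝ) < 1 / (2 * finrank ℚ K) := by positivity
    linarith
  have hθ0 : (0 : ℝ) < 1 - 1 / (2 * finrank ℚ K) := by
    rw [sub_pos, div_lt_one (by positivity)]; linarith
  have hO : (fun s : ℝ ↦ (Nat.card {I : (Ideal (𝓞 K))⁰ // absNorm (I : Ideal (𝓞 K)) ≤ s} : ℝ) -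
        (∑ C, ρ C) * s) =O[atTop] fun s ↦ s ^ (1 - 1 / (2 * finrank ℚ K) : ℝ) := by
    refine (IsBigO.sum fun C (_ : C ∈ Finset.univ) ↦ hρ C).congr' ?_ EventuallyEq.rfl
    filter_upwards [eventually_ge_atTop 0] with s hs
    have : Fintype {I : (Ideal (𝓞 K))⁰ // absNorm (I : Ideal (𝓞 K)) ≤ s} := by
      simp_rw [← Nat.le_floor_iff hs]
      refine @Fintype.ofFinite _ (finite_setOfPred_absNorm_le₀ ⌊s⌋₊)
    let e := fun C : ClassGroup (𝓞 K) ↦ Equiv.subtypeSubtypeEquivSubtypeInter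
      (fun I : (Ideal (𝓞 K))⁰ ↦ absNorm I.1 ≤ s) (fun I ↦ ClassGroup.mk0 I = C)
    rw [Finset.sum_apply, Finset.sum_sub_distrib, Finset.sum_mul]
    congr 1
    simp_rw [← Nat.card_congr (e _), Nat.card_eq_fintype_card, Fintype.subtype_card]
    rw [Fintype.card, Finset.card_eq_sum_card_fiberwise (f := fun I ↦ ClassGroup.mk0 I.1)
      (t := Finset.univ) (fun _ _ ↦ Finset.mem_univ _), Nat.cast_sum]
  refine ⟨∑ C, ρ C, _, ?_, hθ0, hθ1, hO⟩
  -- The constants `ρ C` come without a sign. Uniqueness of limits identifies their sum with the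
  -- residue of the Dedekind zeta function, which is positive.
  have hlim := NumberField.Ideal.tendsto_norm_le_div_atTop₀ K
  have hlo : (fun s : ℝ ↦ s ^ (1 - 1 / (2 * finrank ℚ K) : ℝ)) =o[atTop] fun s : ℝ ↦ s := by
    refine (isLittleO_iff_tendsto' ?_).mpr ?_
    · filter_upwards [eventually_gt_atTop 0] with s hs h
      exact absurd h hs.ne'
    · refine (tendsto_rpow_neg_atTop (y := 1 / (2 * finrank ℚ K)) (by positivity)).congr' ?_
      filter_upwards [eventually_gt_atTop 0] with s hs
      rw [← Real.rpow_sub_one hs.ne']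
      congr 1
      ring
  have h0 := (hO.trans_isLittleO hlo).tendsto_div_nhds_zero
  have h1 : Tendsto (fun s : ℝ ↦
      (Nat.card {I : (Ideal (𝓞 K))⁰ // absNorm (I : Ideal (𝓞 K)) ≤ s} : ℝ) / s) atTop
      (𝓝 (∑ C, ρ C)) := by
    have := h0.add_const (∑ C, ρ C)
    rw [zero_add] at this
    refine this.congr' ?_
    filter_upwards [eventually_gt_atTop 0] with s hs
    field_simp
    ring
  rw [tendsto_nhds_unique h1 hlim, show (2 ^ nrRealPlaces K * (2 * Real.pi) ^ nrComplexPlaces K *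
    regulator K * classNumber K) / (torsionOrder K * Real.sqrt |(discr K : ℝ)|) =
      dedekindZeta_residue K by rw [dedekindZeta_residue_def]]
  exact dedekindZeta_residue_pos K

end IdealCount

/-! ### Analytic continuation of Dirichlet series, and grouping of terms by norm. -/

section DirichletSeries

open Asymptotics MeasureTheory

theorem locallyIntegrable_sum_Icc_floor {f : ℕ → ℝ} (hf : ∀ n, 0 ≤ f n) :
    LocallyIntegrable fun t : ℝ ↦ ∑ k ∈ Finset.Icc 1 ⌊t⌋₊, f k := by
  refine Monotone.locallyIntegrable fun a b hab ↦ ?_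
  exact Finset.sum_le_sum_of_subset_of_nonneg
    (Finset.Icc_subset_Icc_right (Nat.floor_mono hab)) fun i _ _ ↦ hf i

/-- A Dirichlet series with non-negative coefficients whose summatory function is
`ρ t + O(t ^ θ)` continues analytically to `θ < Re s`, up to a simple pole at `1`. -/
theorem exists_differentiableOn_sub_one_mul_LSeries {f : ℕ → ℝ} (hf : ∀ n, 0 ≤ f n) {ρ θ : ℝ}
    (hθ1 : θ < 1)
    (hO : (fun t : ℝ ↦ ∑ k ∈ Finset.Icc 1 ⌊t⌋₊, f k - ρ * t) =O[atTop] fun t ↦ t ^ θ) :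
    (∀ s : ℂ, 1 < s.re → LSeriesSummable (fun n ↦ (f n : ℂ)) s) ∧
    ∃ H : ℂ → ℂ, DifferentiableOn ℂ H {s | θ < s.re} ∧ H 1 = ρ ∧
      ∀ s : ℂ, 1 < s.re → H s = (s - 1) * LSeries (fun n ↦ (f n : ℂ)) s := by
  have hO1 : (fun n : ℕ ↦ ∑ k ∈ Finset.Icc 1 n, f k) =O[atTop] fun n ↦ (n : ℝ) ^ (1 : ℝ) := by
    have h1 : (fun t : ℝ ↦ ∑ k ∈ Finset.Icc 1 ⌊t⌋₊, f k) =O[atTop] fun t ↦ t ^ (1 : ℝ) := by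
      have h2 : (fun t : ℝ ↦ t ^ θ) =O[atTop] fun t ↦ t ^ (1 : ℝ) := by
        refine IsBigO.of_bound 1 ?_
        filter_upwards [eventually_ge_atTop 1] with t ht
        rw [one_mul, Real.norm_of_nonneg (by positivity), Real.norm_of_nonneg (by positivity)]
        exact Real.rpow_le_rpow_of_exponent_le ht hθ1.le
      have h3 : (fun t : ℝ ↦ ρ * t) =O[atTop] fun t ↦ t ^ (1 : ℝ) := by
        simpa using (isBigO_refl (fun t : ℝ ↦ t) atTop).const_mul_left ρ
      simpa using (hO.trans h2).add h3
    simpa [Function.comp_def] using h1.comp_tendsto tendsto_natCast_atTop_atTop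
  refine ⟨fun s hs ↦ LSeriesSummable_of_sum_norm_bigO_and_nonneg hO1 hf zero_le_one hs, ?_⟩
  set E : ℝ → ℝ := fun t ↦ ∑ k ∈ Finset.Icc 1 ⌊t⌋₊, f k - ρ * t with hE
  set F : ℝ → ℂ := (Set.Ioi 1).indicator fun t ↦ (E t : ℂ) with hF
  have hEint : LocallyIntegrable E :=
    (locallyIntegrable_sum_Icc_floor hf).sub (by fun_prop : Continuous _).locallyIntegrable
  have hFint : LocallyIntegrableOn F (Set.Ioi 0) := by
    refine LocallyIntegrable.locallyIntegrableOn
      (LocallyIntegrable.indicator ?_ measurableSet_Ioi) _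
    intro x
    obtain ⟨U, hU, hi⟩ := hEint x
    exact ⟨U, hU, hi.ofReal⟩
  have hFtop : F =O[atTop] fun t : ℝ ↦ t ^ (-(-θ)) := by
    rw [neg_neg]
    refine (IsBigO.of_norm_left (f' := fun t ↦ (E t : ℂ)) ?_).congr' ?_ EventuallyEq.rfl
    · simpa using hO.norm_left
    · filter_upwards [eventually_gt_atTop 1] with t ht
      rw [hF, Set.indicator_of_mem (Set.mem_Ioi.mpr ht)]
  have hFzero (b : ℝ) : F =O[𝓝[>] 0] fun t : ℝ ↦ t ^ (-b) := by
    refine (isBigO_zero _ _).congr' ?_ EventuallyEq.rfl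
    filter_upwards [nhdsWithin_le_nhds (Iio_mem_nhds zero_lt_one)] with t ht
    rw [hF, Set.indicator_of_notMem (by simpa using ht.le)]
  -- Abel summation writes the series as s times the integral of ψ(t) t^(-s-1) over t > 1, with ψ
  -- the summatory function. The main term ρt contributes ρ / (s - 1), and the remainder is a Mellin
  -- transform, holomorphic for Re s > θ. `F` vanishes on (0, 1], so there is no condition at 0.
  refine ⟨fun s ↦ s * ((s - 1) * mellin F (-s) + ρ), ?_, by simp, fun s hs ↦ ?_⟩
  · intro s hs
    have hm : DifferentiableAt ℂ (mellin F) (-s) :=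
      mellin_differentiableAt_of_isBigO_rpow hFint hFtop (by simpa using hs)
        (hFzero (-s.re - 1)) (by simp)
    have hm' : DifferentiableAt ℂ (fun s ↦ mellin F (-s)) s :=
      hm.comp s (differentiable_neg s)
    exact (by fun_prop : DifferentiableAt ℂ (fun s ↦ s * ((s - 1) * mellin F (-s) + ρ)) s
      ).differentiableWithinAt
  · have hs1 : s - 1 ≠ 0 := fun h ↦ by
      rw [sub_eq_zero] at h; simp [h] at hs
    have hmc : MellinConvergent F (-s) :=
      mellinConvergent_of_isBigO_rpow hFint hFtop (by simpa using hθ1.trans hs)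
        (hFzero (-s.re - 1)) (by simp)
    have hind : (fun t : ℝ ↦ (t : ℂ) ^ (-s - 1) • F t) =
        (Set.Ioi 1).indicator fun t : ℝ ↦ (t : ℂ) ^ (-s - 1) * (E t : ℂ) := by
      ext t
      by_cases ht : t ∈ Set.Ioi (1 : ℝ)
      · simp only [hF, Set.indicator_of_mem ht, smul_eq_mul]
      · simp only [hF, Set.indicator_of_notMem ht, smul_zero]
    have hsub : Set.Ioi (1 : ℝ) ⊆ Set.Ioi 0 := Set.Ioi_subset_Ioi zero_le_one
    have hi1 : IntegrableOn (fun t : ℝ ↦ (t : ℂ) ^ (-s - 1) * (E t : ℂ)) (Set.Ioi 1) := by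
      rw [MellinConvergent, hind, integrableOn_indicator_iff measurableSet_Ioi,
        Set.inter_eq_left.mpr hsub] at hmc
      exact hmc
    have hmel : mellin F (-s) = ∫ t : ℝ in Set.Ioi 1, (t : ℂ) ^ (-s - 1) * (E t : ℂ) := by
      rw [mellin, hind, setIntegral_indicator measurableSet_Ioi, Set.inter_eq_right.mpr hsub]
    have hi2 : IntegrableOn (fun t : ℝ ↦ (ρ : ℂ) * (t : ℂ) ^ (-s)) (Set.Ioi 1) :=
      (integrableOn_Ioi_cpow_of_lt (by simpa using hs) zero_lt_one).const_mul _
    have hint : ∫ t : ℝ in Set.Ioi 1, (ρ : ℂ) * (t : ℂ) ^ (-s) = ρ / (s - 1) := by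
      rw [integral_const_mul, integral_Ioi_cpow_of_lt (by simpa using hs) zero_lt_one]
      rw [Complex.ofReal_one, Complex.one_cpow, show -s + 1 = -(s - 1) by ring, neg_div_neg_eq,
        mul_one_div]
    rw [LSeries_eq_mul_integral_of_nonneg f zero_le_one hs hO1 hf]
    have hsplit : ∫ t : ℝ in Set.Ioi 1, (∑ k ∈ Finset.Icc 1 ⌊t⌋₊, (f k : ℂ)) *
        (t : ℂ) ^ (-(s + 1)) = mellin F (-s) + ρ / (s - 1) := by
      rw [hmel, ← hint, ← integral_add hi1 hi2]
      refine setIntegral_congr_fun measurableSet_Ioi fun t ht ↦ ?_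
      have ht0 : (t : ℂ) ≠ 0 := by
        exact_mod_cast (zero_lt_one.trans (Set.mem_Ioi.mp ht)).ne'
      have : (t : ℂ) ^ (-s) = (t : ℂ) ^ (-s - 1) * t := by
        rw [Complex.cpow_sub _ _ ht0, Complex.cpow_one, div_mul_cancel₀ _ ht0]
      simp only [hE, this]
      push_cast
      rw [neg_add']
      ring
    rw [hsplit]
    field_simp

variable {ι : Type*} {N : ι → ℕ}

/-- The coefficient at `n` of the Dirichlet series `∑ i, w i * N i ^ (-s)`. -/
noncomputable def fiberSum (hN : ∀ n, (N ⁻¹' {n}).Finite) (w : ι → ℝ) (n : ℕ) : ℝ :=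
  ∑ i ∈ (hN n).toFinset, w i

theorem fiberSum_nonneg (hN : ∀ n, (N ⁻¹' {n}).Finite) {w : ι → ℝ} (hw : ∀ i, 0 ≤ w i) (n : ℕ) :
    0 ≤ fiberSum hN w n :=
  Finset.sum_nonneg fun i _ ↦ hw i

theorem sum_fiberSum (hN : ∀ n, (N ⁻¹' {n}).Finite) (hN0 : ∀ i, N i ≠ 0) (w : ι → ℝ) {n : ℕ}
    {T : Finset ι} (hT : ∀ i, i ∈ T ↔ N i ≤ n) :
    ∑ k ∈ Finset.Icc 1 n, fiberSum hN w k = ∑ i ∈ T, w i := by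
  classical
  rw [← Finset.sum_fiberwise_of_maps_to (t := Finset.Icc 1 n) (g := N) (f := w) fun i hi ↦
    Finset.mem_Icc.mpr ⟨Nat.one_le_iff_ne_zero.mpr (hN0 i), (hT i).mp hi⟩]
  refine Finset.sum_congr rfl fun k hk ↦ Finset.sum_congr ?_ fun _ _ ↦ rfl
  ext i
  simp only [Set.Finite.mem_toFinset, Set.mem_preimage, Set.mem_singleton_iff, Finset.mem_filter,
    hT]
  exact ⟨fun h ↦ ⟨h ▸ (Finset.mem_Icc.mp hk).2, h⟩, fun h ↦ h.2⟩

theorem tsum_fiber_eq_term (hN : ∀ n, (N ⁻¹' {n}).Finite) (hN0 : ∀ i, N i ≠ 0) (w : ι → ℝ)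
    (s : ℂ) (n : ℕ) :
    ∑' i : {i // N i = n}, (w i : ℂ) * (N i : ℂ) ^ (-s) =
      LSeries.term (fun n ↦ (fiberSum hN w n : ℂ)) s n := by
  have : Finite {i // N i = n} := hN n
  have := Fintype.ofFinite {i // N i = n}
  rw [tsum_fintype]
  have hsum (g : ι → ℂ) : ∑ i : {i // N i = n}, g i = ∑ i ∈ (hN n).toFinset, g i :=
    (Finset.sum_subtype _ (fun i ↦ by simp) g).symm
  rw [hsum fun i ↦ (w i : ℂ) * (N i : ℂ) ^ (-s)]
  rcases eq_or_ne n 0 with rfl | hn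
  · rw [LSeries.term_zero]
    refine Finset.sum_eq_zero fun i hi ↦ absurd (by simpa using hi) (hN0 i)
  · rw [LSeries.term_of_ne_zero hn, fiberSum, Complex.ofReal_sum, Finset.sum_div]
    refine Finset.sum_congr rfl fun i hi ↦ ?_
    have : N i = n := by simpa using hi
    rw [this, Complex.cpow_neg, div_eq_mul_inv]

theorem norm_weight_mul_cpow (hN0 : ∀ i, N i ≠ 0) {w : ι → ℝ} (hw : ∀ i, 0 ≤ w i) (s : ℂ)
    (i : ι) : ‖(w i : ℂ) * (N i : ℂ) ^ (-s)‖ = w i * (N i : ℝ) ^ (-s.re) := by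
  rw [norm_mul, Complex.norm_natCast_cpow_of_pos (Nat.pos_of_ne_zero (hN0 i)), Complex.neg_re,
    Complex.norm_of_nonneg (hw i)]

/-- The absolute values of the terms depend only on Re s, and at a real point all terms are
nonnegative, so the grouping by norm can be undone. -/
theorem summable_of_LSeriesSummable_fiberSum (hN : ∀ n, (N ⁻¹' {n}).Finite)
    (hN0 : ∀ i, N i ≠ 0) {w : ι → ℝ} (hw : ∀ i, 0 ≤ w i) {s : ℂ}
    (hs : LSeriesSummable (fun n ↦ (fiberSum hN w n : ℂ)) s) :
    Summable fun i ↦ w i * (N i : ℝ) ^ (-s.re) := by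
  have hnonneg (i : ι) : 0 ≤ w i * (N i : ℝ) ^ (-s.re) := mul_nonneg (hw i) (by positivity)
  rw [← (Equiv.sigmaFiberEquiv N).summable_iff]
  refine (summable_sigma_of_nonneg fun x ↦ hnonneg _).mpr ⟨fun n ↦ ?_, ?_⟩
  · have : Finite {i // N i = n} := hN n
    exact .of_finite
  · refine hs.norm.congr fun n ↦ ?_
    have h := tsum_fiber_eq_term hN hN0 w (s.re : ℂ) n
    have h' : ((∑' i : {i // N i = n}, w i * (N i : ℝ) ^ (-s.re) : ℝ) : ℂ) =
        LSeries.term (fun n ↦ (fiberSum hN w n : ℂ)) (s.re : ℂ) n := by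
      rw [← h, Complex.ofReal_tsum]
      refine tsum_congr fun i ↦ ?_
      rw [Complex.ofReal_mul, Complex.ofReal_cpow (Nat.cast_nonneg _)]
      simp
    have h'' := congrArg norm h'
    rw [Complex.norm_of_nonneg (tsum_nonneg fun i : {i // N i = n} ↦ hnonneg i)] at h''
    rw [LSeries.norm_term_eq] at h'' ⊢
    simpa using h''.symm

theorem hasSum_LSeries_fiberSum (hN : ∀ n, (N ⁻¹' {n}).Finite)
    (hN0 : ∀ i, N i ≠ 0) {w : ι → ℝ} (hw : ∀ i, 0 ≤ w i) {s : ℂ}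
    (hs : LSeriesSummable (fun n ↦ (fiberSum hN w n : ℂ)) s) :
    HasSum (fun i ↦ (w i : ℂ) * (N i : ℂ) ^ (-s)) (LSeries (fun n ↦ (fiberSum hN w n : ℂ)) s) := by
  have hsum : Summable fun i ↦ (w i : ℂ) * (N i : ℂ) ^ (-s) := by
    refine Summable.of_norm ?_
    simp_rw [norm_weight_mul_cpow hN0 hw]
    exact summable_of_LSeriesSummable_fiberSum hN hN0 hw hs
  convert hsum.hasSum using 1
  rw [← (Equiv.sigmaFiberEquiv N).tsum_eq]
  refine Eq.trans ?_ ((Equiv.sigmaFiberEquiv N).summable_iff.mpr hsum).tsum_sigma.symm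
  exact tsum_congr fun n ↦ (tsum_fiber_eq_term hN hN0 w s n).symm

end DirichletSeries

/-! ### Euler products over the ideals of a Dedekind domain. -/

section EulerProduct

open scoped nonZeroDivisors

variable {R : Type*} [CommRing R] [IsDedekindDomain R]

namespace IsDedekindDomain.HeightOneSpectrum

/-- A maximal ideal of a Dedekind domain as an element of the monoid of nonzero ideals. -/
def nonzeroIdeal (p : HeightOneSpectrum R) : (Ideal R)⁰ :=
  ⟨p.asIdeal, mem_nonZeroDivisors_of_ne_zero p.ne_bot⟩

theorem coe_nonzeroIdeal (p : HeightOneSpectrum R) : (p.nonzeroIdeal : Ideal R) = p.asIdeal := rfl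

theorem nonzeroIdeal_injective :
    Function.Injective (nonzeroIdeal : HeightOneSpectrum R → (Ideal R)⁰) :=
  fun _ _ h ↦ HeightOneSpectrum.ext (congrArg Subtype.val h)

end IsDedekindDomain.HeightOneSpectrum

open HeightOneSpectrum

/-- The nonzero ideals all of whose prime factors lie in `S`. -/
def factoredIdeals (S : Finset (HeightOneSpectrum R)) : Set (Ideal R)⁰ :=
  {I | ∀ q : HeightOneSpectrum R, q.asIdeal ∣ I → q ∈ S}

theorem factoredIdeals_empty : factoredIdeals (∅ : Finset (HeightOneSpectrum R)) = {1} := by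
  ext I
  simp only [factoredIdeals, Finset.notMem_empty, imp_false, Set.mem_ofPred_eq,
    Set.mem_singleton_iff]
  constructor
  · intro h
    by_contra hI
    have hI1 : (I : Ideal R) ≠ ⊤ := fun h' ↦ hI (Subtype.ext (by simpa using h'))
    obtain ⟨M, hM, hle⟩ := Ideal.exists_le_maximal _ hI1
    have hI0 : (I : Ideal R) ≠ ⊥ := nonZeroDivisors.coe_ne_zero I
    refine h ⟨M, hM.isPrime, fun h0 ↦ hI0 (le_bot_iff.mp (h0 ▸ hle))⟩ ?_
    exact Ideal.dvd_iff_le.mpr hle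
  · rintro rfl q hq
    exact q.isPrime.ne_top (by simpa using Ideal.isUnit_iff.mp (isUnit_of_dvd_one hq))

theorem eq_of_asIdeal_dvd {p q : HeightOneSpectrum R} (h : q.asIdeal ∣ p.asIdeal) : q = p := by
  refine HeightOneSpectrum.ext ?_
  exact (associated_iff_eq.mp ((q.prime).dvd_prime_iff_associated p.prime |>.mp h))

theorem nonzeroIdeal_mul_mem_factoredIdeals_iff {S : Finset (HeightOneSpectrum R)}
    {p : HeightOneSpectrum R} (hp : p ∈ S) (J : (Ideal R)⁰) :
    p.nonzeroIdeal * J ∈ factoredIdeals S ↔ J ∈ factoredIdeals S := by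
  constructor
  · intro h q hq
    exact h q (hq.mul_left _)
  · intro h q hq
    rcases q.prime.dvd_or_dvd hq with hq | hq
    · exact eq_of_asIdeal_dvd hq ▸ hp
    · exact h q hq

omit [IsDedekindDomain R] in
theorem mem_factoredIdeals_iff_of_notMem [DecidableEq (HeightOneSpectrum R)]
    {S : Finset (HeightOneSpectrum R)}
    {p : HeightOneSpectrum R} (hp : p ∉ S) (J : (Ideal R)⁰) :
    J ∈ factoredIdeals S ↔ J ∈ factoredIdeals (insert p S) ∧ ¬ p.asIdeal ∣ J := by
  constructor
  · exact fun h ↦ ⟨fun q hq ↦ Finset.mem_insert_of_mem (h q hq), fun hd ↦ hp (h p hd)⟩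
  · rintro ⟨h, hpJ⟩ q hq
    refine (Finset.mem_insert.mp (h q hq)).resolve_left ?_
    rintro rfl
    exact hpJ hq

/-- Multiplication by p maps the ideals supported on S ∪ {p} bijectively onto those among them
divisible by p. Multiplying the sum by 1 - f(p) therefore removes exactly these and leaves the sum
over the ideals supported on S. -/
theorem tsum_indicator_factoredIdeals {f : (Ideal R)⁰ →* ℂ} (hf : Summable fun I ↦ ‖f I‖)
    (hf1 : ∀ p : HeightOneSpectrum R, ‖f p.nonzeroIdeal‖ < 1) (S : Finset (HeightOneSpectrum R)) :
    ∑' I, (factoredIdeals S).indicator f I = ∏ p ∈ S, (1 - f p.nonzeroIdeal)⁻¹ := by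
  classical
  induction S using Finset.induction_on with
  | empty =>
    rw [factoredIdeals_empty, tsum_eq_single 1]
    · simp
    · intro I hI
      simp [hI]
  | insert p S hp ih =>
    have hne : 1 - f p.nonzeroIdeal ≠ 0 := by
      intro h
      have := hf1 p
      rw [← sub_eq_zero.mp h, norm_one] at this
      exact lt_irrefl _ this
    rw [Finset.prod_insert hp, ← ih, eq_inv_mul_iff_mul_eq₀ hne, sub_mul, one_mul, ← tsum_mul_left]
    set g := (factoredIdeals (insert p S)).indicator f with hg
    have hinj : Function.Injective fun J : (Ideal R)⁰ ↦ p.nonzeroIdeal * J := by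
      intro J J' h
      exact Subtype.ext (mul_left_cancel₀ p.ne_bot (congrArg Subtype.val h))
    have hsum (A : Set (Ideal R)⁰) : Summable (A.indicator f) := hf.of_norm.indicator A
    have hshift : ∑' J, f p.nonzeroIdeal * g J =
        ∑' J, {I : (Ideal R)⁰ | p.asIdeal ∣ I}.indicator g J := by
      rw [← hinj.tsum_eq (f := {I : (Ideal R)⁰ | p.asIdeal ∣ I}.indicator g)]
      · refine tsum_congr fun J ↦ ?_
        have hd : p.nonzeroIdeal * J ∈ {I : (Ideal R)⁰ | p.asIdeal ∣ I} := dvd_mul_right _ _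
        rw [Set.indicator_of_mem hd, hg]
        by_cases hJ : J ∈ factoredIdeals (insert p S)
        · rw [Set.indicator_of_mem hJ, Set.indicator_of_mem
            ((nonzeroIdeal_mul_mem_factoredIdeals_iff (Finset.mem_insert_self _ _) J).mpr hJ),
            map_mul]
        · rw [Set.indicator_of_notMem hJ, Set.indicator_of_notMem
            (mt (nonzeroIdeal_mul_mem_factoredIdeals_iff (Finset.mem_insert_self _ _) J).mp hJ),
            mul_zero]
      · intro I hI
        have hI' : I ∈ {I : (Ideal R)⁰ | p.asIdeal ∣ I} := by
          by_contra h
          exact hI (Set.indicator_of_notMem h _)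
        obtain ⟨J, hJ⟩ := hI'
        have hJ0 : J ≠ 0 := by
          rintro rfl
          exact nonZeroDivisors.coe_ne_zero I (by simpa using hJ)
        exact ⟨⟨J, mem_nonZeroDivisors_of_ne_zero hJ0⟩, Subtype.ext hJ.symm⟩
    rw [hshift, ← ((hsum _).tsum_sub ((hsum _).indicator _))]
    refine tsum_congr fun I ↦ ?_
    by_cases hI : I ∈ factoredIdeals S
    · obtain ⟨h1, h2⟩ := (mem_factoredIdeals_iff_of_notMem hp I).mp hI
      rw [Set.indicator_of_mem hI,
        Set.indicator_of_notMem (s := {I : (Ideal R)⁰ | p.asIdeal ∣ I}) h2,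
        sub_zero, Set.indicator_of_mem h1]
    · rw [Set.indicator_of_notMem hI]
      by_cases hd : p.asIdeal ∣ I
      · rw [Set.indicator_of_mem (s := {I : (Ideal R)⁰ | p.asIdeal ∣ I}) hd, sub_self]
      · rw [Set.indicator_of_notMem (s := {I : (Ideal R)⁰ | p.asIdeal ∣ I}) hd, sub_zero,
          Set.indicator_of_notMem fun h ↦ hI ((mem_factoredIdeals_iff_of_notMem hp I).mpr ⟨h, hd⟩)]

/-- The Euler product of a completely multiplicative function on the nonzero ideals of a
Dedekind domain. -/
theorem hasProd_one_sub_inv_nonzeroIdeal {f : (Ideal R)⁰ →* ℂ} (hf : Summable fun I ↦ ‖f I‖)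
    (hf1 : ∀ p : HeightOneSpectrum R, ‖f p.nonzeroIdeal‖ < 1) :
    HasProd (fun p : HeightOneSpectrum R ↦ (1 - f p.nonzeroIdeal)⁻¹) (∑' I, f I) := by
  have h := tendsto_tsum_of_dominated_convergence (𝓕 := atTop)
    (f := fun S : Finset (HeightOneSpectrum R) ↦ (factoredIdeals S).indicator f) (g := f) hf ?_
    (.of_forall fun S I ↦ norm_indicator_le_norm_self _ _)
  · simp_rw [tsum_indicator_factoredIdeals hf hf1] at h
    exact h
  · intro I
    -- The indicators converge pointwise because `I` is counted as soon as `S` contains its finitely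
    -- many prime factors.
    have hfin : {q : HeightOneSpectrum R | q.asIdeal ∣ I}.Finite :=
      Ideal.finite_factors (nonZeroDivisors.coe_ne_zero I)
    refine tendsto_const_nhds.congr' ?_
    filter_upwards [eventually_ge_atTop hfin.toFinset] with S hS
    rw [Set.indicator_of_mem]
    exact fun q hq ↦ hS (by simpa using hq)

end EulerProduct

/-! ### Non-vanishing on Re s = 1 for Euler products over arbitrary integers `N i ≥ 2`. -/

section BeurlingPrimes

open Complex

/-- In the Taylor series of the logarithms, the n-th term combines to (2aⁿ / n)(1 + Re zⁿ)² for n ≥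
1, because Re z²ⁿ = 2(Re zⁿ)² - 1 on the unit circle. -/
theorem three_four_one_neg_log_one_sub_nonneg {a : ℝ} (ha₀ : 0 ≤ a) (ha₁ : a < 1) {z : ℂ}
    (hz : ‖z‖ = 1) :
    0 ≤ 3 * (-log (1 - a)).re + 4 * (-log (1 - a * z)).re + (-log (1 - a * z ^ 2)).re := by
  have hac₀ : ‖(a : ℂ)‖ < 1 := by
    simp only [Complex.norm_of_nonneg ha₀, ha₁]
  have hac₁ : ‖a * z‖ < 1 := by rwa [norm_mul, hz, mul_one]
  have hac₂ : ‖a * z ^ 2‖ < 1 := by rwa [norm_mul, norm_pow, hz, one_pow, mul_one]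
  rw [← ((hasSum_re <| hasSum_taylorSeries_neg_log hac₀).mul_left 3).add
    ((hasSum_re <| hasSum_taylorSeries_neg_log hac₁).mul_left 4) |>.add
    (hasSum_re <| hasSum_taylorSeries_neg_log hac₂) |>.tsum_eq]
  refine tsum_nonneg fun n ↦ ?_
  simp only [← ofReal_pow, div_natCast_re, ofReal_re, mul_pow, mul_re, ofReal_im, zero_mul,
    sub_zero]
  rcases n.eq_zero_or_pos with rfl | hn
  · simp
  · simp only [← mul_div_assoc, ← add_div]
    refine div_nonneg ?_ n.cast_nonneg
    rw [← pow_mul, pow_mul', sq, mul_re, ← sq, ← sq, ← sq_norm_sub_sq_re, norm_pow, hz]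
    convert! (show 0 ≤ 2 * a ^ n * ((z ^ n).re + 1) ^ 2 by positivity) using 1
    ring

variable {ι : Type*} {N : ι → ℕ}

theorem norm_natCast_cpow_neg_le_half {n : ℕ} (hn : 2 ≤ n) {s : ℂ} (hs : 1 ≤ s.re) :
    ‖(n : ℂ) ^ (-s)‖ ≤ 1 / 2 := by
  have h2 : (2 : ℝ) ≤ n := by exact_mod_cast hn
  rw [norm_natCast_cpow_of_pos (by lia), neg_re]
  calc (n : ℝ) ^ (-s.re) ≤ (n : ℝ) ^ (-1 : ℝ) :=
        Real.rpow_le_rpow_of_exponent_le (by linarith) (by linarith)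
    _ ≤ 1 / 2 := by
        rw [Real.rpow_neg_one, one_div]
        exact inv_anti₀ two_pos h2

theorem half_le_norm_one_sub_natCast_cpow_neg {n : ℕ} (hn : 2 ≤ n) {s : ℂ} (hs : 1 ≤ s.re) :
    1 / 2 ≤ ‖1 - (n : ℂ) ^ (-s)‖ := by
  have h := norm_sub_norm_le (1 : ℂ) ((n : ℂ) ^ (-s))
  rw [norm_one] at h
  linarith [norm_natCast_cpow_neg_le_half hn hs]

theorem one_sub_natCast_cpow_neg_ne_zero {n : ℕ} (hn : 2 ≤ n) {s : ℂ} (hs : 1 ≤ s.re) :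
    1 - (n : ℂ) ^ (-s) ≠ 0 := by
  rw [← norm_pos_iff]
  linarith [half_le_norm_one_sub_natCast_cpow_neg hn hs]

theorem one_sub_natCast_cpow_neg_mem_slitPlane {n : ℕ} (hn : 2 ≤ n) {s : ℂ} (hs : 1 ≤ s.re) :
    1 - (n : ℂ) ^ (-s) ∈ slitPlane := by
  refine .inl ?_
  have := (re_le_norm ((n : ℂ) ^ (-s))).trans (norm_natCast_cpow_neg_le_half hn hs)
  rw [sub_re, one_re]
  linarith

theorem summable_log_mul_rpow_neg (hN : ∀ i, 2 ≤ N i)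
    (hsum : ∀ σ : ℝ, 1 < σ → Summable fun i ↦ (N i : ℝ) ^ (-σ)) {σ : ℝ} (hσ : 1 < σ) :
    Summable fun i ↦ Real.log (N i) * (N i : ℝ) ^ (-σ) := by
  have hε : 0 < (σ - 1) / 2 := by linarith
  refine Summable.of_nonneg_of_le (fun i ↦ mul_nonneg (Real.log_natCast_nonneg _) (by positivity))
    (fun i ↦ ?_) ((hsum ((σ + 1) / 2) (by linarith)).mul_left ((σ - 1) / 2)⁻¹)
  have hpos : (0 : ℝ) < N i := by exact_mod_cast (by lia : 0 < 2).trans_le (hN i)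
  calc Real.log (N i) * (N i : ℝ) ^ (-σ)
      ≤ ((N i : ℝ) ^ ((σ - 1) / 2) / ((σ - 1) / 2)) * (N i : ℝ) ^ (-σ) := by
        gcongr
        exact Real.log_le_rpow_div hpos.le hε
    _ = ((σ - 1) / 2)⁻¹ * (N i : ℝ) ^ (-((σ + 1) / 2)) := by
        rw [show -((σ + 1) / 2) = (σ - 1) / 2 + -σ by ring, Real.rpow_add hpos]
        ring

/-- The logarithm of the Euler product `∏ i, (1 - N i ^ (-s))⁻¹`. -/
noncomputable def eulerLog (N : ι → ℕ) (s : ℂ) : ℂ :=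
  ∑' i, -log (1 - (N i : ℂ) ^ (-s))

theorem summable_natCast_cpow_neg (hN : ∀ i, 2 ≤ N i)
    (hsum : ∀ σ : ℝ, 1 < σ → Summable fun i ↦ (N i : ℝ) ^ (-σ)) {s : ℂ} (hs : 1 < s.re) :
    Summable fun i ↦ (N i : ℂ) ^ (-s) := by
  refine Summable.of_norm ((hsum _ hs).congr fun i ↦ ?_)
  rw [norm_natCast_cpow_of_pos (by have := hN i; lia), neg_re]

theorem summable_neg_log_one_sub (hN : ∀ i, 2 ≤ N i)
    (hsum : ∀ σ : ℝ, 1 < σ → Summable fun i ↦ (N i : ℝ) ^ (-σ)) {s : ℂ} (hs : 1 < s.re) :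
    Summable fun i ↦ -log (1 - (N i : ℂ) ^ (-s)) :=
  (summable_natCast_cpow_neg hN hsum hs).clog_one_sub.neg

theorem hasDerivAt_neg_log_one_sub {n : ℕ} (hn : 2 ≤ n) {s : ℂ} (hs : 1 ≤ s.re) :
    HasDerivAt (fun s : ℂ ↦ -log (1 - (n : ℂ) ^ (-s)))
      (-(Real.log n * (n : ℂ) ^ (-s) / (1 - (n : ℂ) ^ (-s)))) s := by
  have hn0 : (n : ℂ) ≠ 0 := by exact_mod_cast (by lia : n ≠ 0)
  have h1 : HasDerivAt (fun s : ℂ ↦ 1 - (n : ℂ) ^ (-s)) (Real.log n * (n : ℂ) ^ (-s)) s := by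
    have := ((hasDerivAt_neg s).const_cpow (c := (n : ℂ)) (.inl hn0)).const_sub 1
    refine this.congr_deriv ?_
    rw [← natCast_log]
    ring
  exact (h1.clog (one_sub_natCast_cpow_neg_mem_slitPlane hn hs)).neg

/-- Termwise differentiation is justified on a half-plane Re z > c with 1 < c < Re s, where |1 -
N^(-z)| ≥ 1/2 bounds the derivatives by 2 log N · N^(-c). -/
theorem hasDerivAt_eulerLog (hN : ∀ i, 2 ≤ N i)
    (hsum : ∀ σ : ℝ, 1 < σ → Summable fun i ↦ (N i : ℝ) ^ (-σ)) {s : ℂ} (hs : 1 < s.re) :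
    HasDerivAt (eulerLog N)
      (∑' i, -(Real.log (N i) * (N i : ℂ) ^ (-s) / (1 - (N i : ℂ) ^ (-s)))) s := by
  obtain ⟨c, hc1, hcs⟩ := exists_between hs
  have hopen : IsOpen {z : ℂ | c < z.re} := isOpen_lt continuous_const continuous_re
  have hconn : IsPreconnected {z : ℂ | c < z.re} := (convex_halfSpace_re_gt c).isPreconnected
  refine hasDerivAt_tsum_of_isPreconnected (y₀ := s)
    ((summable_log_mul_rpow_neg hN hsum hc1).mul_left 2) hopen hconn
    (fun i z hz ↦ hasDerivAt_neg_log_one_sub (hN i) (hc1.trans hz).le) (fun i z hz ↦ ?_) hcs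
    (summable_neg_log_one_sub hN hsum hs) hcs
  have hz1 : 1 < z.re := hc1.trans hz
  have h1 : (1 : ℝ) ≤ N i := by exact_mod_cast (by lia : 1 ≤ 2).trans (hN i)
  have hlog := Real.log_nonneg h1
  have hz2 : ‖(N i : ℂ) ^ (-z)‖ ≤ (N i : ℝ) ^ (-c) := by
    rw [norm_natCast_cpow_of_pos (by have := hN i; lia), neg_re]
    exact Real.rpow_le_rpow_of_exponent_le h1 (neg_le_neg (le_of_lt hz))
  rw [norm_neg, norm_div, norm_mul, Complex.norm_of_nonneg hlog]
  rw [div_le_iff₀ (by linarith [half_le_norm_one_sub_natCast_cpow_neg (hN i) hz1.le])]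
  calc Real.log (N i) * ‖(N i : ℂ) ^ (-z)‖ ≤ Real.log (N i) * (N i : ℝ) ^ (-c) := by gcongr
    _ = 2 * (Real.log (N i) * (N i : ℝ) ^ (-c)) * (1 / 2) := by ring
    _ ≤ _ := by
        gcongr
        exact half_le_norm_one_sub_natCast_cpow_neg (hN i) hz1.le

theorem one_le_norm_exp_eulerLog_prod (hN : ∀ i, 2 ≤ N i)
    (hsum : ∀ σ : ℝ, 1 < σ → Summable fun i ↦ (N i : ℝ) ^ (-σ)) {x : ℝ} (hx : 1 < x) (t : ℝ) :
    1 ≤ ‖exp (eulerLog N x) ^ 3 * exp (eulerLog N (x + t * I)) ^ 4 *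
      exp (eulerLog N (x + 2 * t * I))‖ := by
  have H₀ := summable_neg_log_one_sub hN hsum (s := x) (by simpa)
  have H₁ := summable_neg_log_one_sub hN hsum (s := x + t * I) (by simpa)
  have H₂ := summable_neg_log_one_sub hN hsum (s := x + 2 * t * I) (by simpa)
  have hsum₀ := (hasSum_re H₀.hasSum).summable.mul_left 3
  have hsum₁ := (hasSum_re H₁.hasSum).summable.mul_left 4
  have hsum₂ := (hasSum_re H₂.hasSum).summable
  simp only [← exp_nat_mul, Nat.cast_ofNat, ← exp_add, norm_exp, add_re, mul_re,
    re_ofNat, im_ofNat, zero_mul, sub_zero, Real.one_le_exp_iff]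
  rw [eulerLog, eulerLog, eulerLog, re_tsum H₀, re_tsum H₁, re_tsum H₂, ← tsum_mul_left,
    ← tsum_mul_left, ← hsum₀.tsum_add hsum₁, ← (hsum₀.add hsum₁).tsum_add hsum₂]
  refine tsum_nonneg fun i ↦ ?_
  have hpos : 0 < N i := by have := hN i; lia
  have hne : (N i : ℂ) ≠ 0 := by exact_mod_cast hpos.ne'
  have hz : ‖(N i : ℂ) ^ (-(t * I))‖ = 1 := by
    rw [norm_natCast_cpow_of_pos hpos]
    simp
  have ha : (N i : ℝ) ^ (-x) < 1 := by
    have := norm_natCast_cpow_neg_le_half (hN i) (s := x) (by simpa using hx.le)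
    rw [norm_natCast_cpow_of_pos hpos, neg_re, ofReal_re] at this
    linarith
  have h := three_four_one_neg_log_one_sub_nonneg (by positivity) ha hz
  have e0 : (((N i : ℝ) ^ (-x) : ℝ) : ℂ) = (N i : ℂ) ^ (-(x : ℂ)) := by
    rw [ofReal_cpow (Nat.cast_nonneg _)]
    simp
  rw [e0, ← cpow_add _ _ hne, ← cpow_nat_mul, ← cpow_add _ _ hne,
    show -(x : ℂ) + -(t * I) = -(x + t * I) by ring,
    show -(x : ℂ) + (2 : ℕ) * -(t * I) = -(x + 2 * t * I) by push_cast; ring] at h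
  exact h

/-- Non-vanishing on the line `Re s = 1` of the analytic continuation of an Euler product. -/
theorem ne_zero_of_eq_sub_one_mul_exp_eulerLog (hN : ∀ i, 2 ≤ N i)
    (hsum : ∀ σ : ℝ, 1 < σ → Summable fun i ↦ (N i : ℝ) ^ (-σ)) {H : ℂ → ℂ} {θ : ℝ} (hθ : θ < 1)
    (hH : DifferentiableOn ℂ H {s | θ < s.re}) (hH1 : H 1 ≠ 0)
    (hHs : ∀ s : ℂ, 1 < s.re → H s = (s - 1) * exp (eulerLog N s)) {s : ℂ} (hs : 1 ≤ s.re) :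
    H s ≠ 0 := by
  have hopen : IsOpen {s : ℂ | θ < s.re} := isOpen_lt continuous_const continuous_re
  have hdiff (z : ℂ) (hz : 1 ≤ z.re) : DifferentiableAt ℂ H z :=
    hH.differentiableAt (hopen.mem_nhds (hθ.trans_le hz))
  rcases hs.lt_or_eq with hs1 | hs1
  · rw [hHs s hs1]
    refine mul_ne_zero (fun h ↦ ?_) (exp_ne_zero _)
    rw [sub_eq_zero] at h
    simp [h] at hs1
  · intro h0
    set t := s.im with ht
    have hst : s = 1 + t * I := by
      apply Complex.ext <;> simp [← hs1, ht]
    have ht0 : t ≠ 0 := fun h ↦ hH1 (by rwa [hst, h, ofReal_zero, zero_mul, add_zero] at h0)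
    have hlim (z : ℂ) (hz : 1 ≤ z.re) :
        Tendsto (fun x : ℝ ↦ H (z + x)) (𝓝[>] 0) (𝓝 (H z)) := by
      have h1 : Tendsto (fun x : ℝ ↦ z + x) (𝓝[>] 0) (𝓝 z) := by
        have : Continuous fun x : ℝ ↦ z + (x : ℂ) := by fun_prop
        simpa using (this.tendsto 0).mono_left nhdsWithin_le_nhds
      exact (hdiff z hz).continuousAt.tendsto.comp h1
    have hquot : Tendsto (fun x : ℝ ↦ H (s + x) / x) (𝓝[>] 0) (𝓝 (deriv H s)) := by
      have h1 := (hdiff s hs).hasDerivAt.tendsto_slope_zero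
      have h2 : Tendsto (fun x : ℝ ↦ (x : ℂ)) (𝓝[>] 0) (𝓝[≠] 0) := by
        refine tendsto_nhdsWithin_iff.mpr ⟨?_, ?_⟩
        · simpa using (continuous_ofReal.tendsto 0).mono_left
            (nhdsWithin_le_nhds (s := Set.Ioi (0 : ℝ)))
        · filter_upwards [self_mem_nhdsWithin] with x hx
          simpa using (Set.mem_Ioi.mp hx).ne'
      refine (h1.comp h2).congr fun x ↦ ?_
      simp [h0, div_eq_inv_mul]
    -- A zero of `H` at s = 1 + it forces this product to 0: the difference quotient stays bounded
    -- and the fourth copy of H(s + x) vanishes in the limit. In terms of the Euler product the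
    -- powers of x cancel, leaving (x + it)⁴(x + 2it) times the 3-4-1 product, whose norm is at
    -- least 1. The limit would then be at least 2|t|⁵ > 0.
    have hL : Tendsto (fun x : ℝ ↦ ‖H (1 + x) ^ 3 * (H (s + x) / x) ^ 3 * H (s + x) *
        H (1 + 2 * t * I + x)‖) (𝓝[>] 0) (𝓝 0) := by
      have := (((((hlim 1 (by simp)).pow 3).mul (hquot.pow 3)).mul (hlim s hs)).mul
        (hlim (1 + 2 * t * I) (by simp))).norm
      simpa [h0] using this
    have hR : Tendsto (fun x : ℝ ↦ ‖(x + t * I : ℂ) ^ 4 * (x + 2 * t * I)‖) (𝓝[>] 0)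
        (𝓝 ‖(t * I : ℂ) ^ 4 * (2 * t * I)‖) := by
      have : Continuous fun x : ℝ ↦ ‖(x + t * I : ℂ) ^ 4 * (x + 2 * t * I)‖ := by fun_prop
      simpa using (this.tendsto 0).mono_left (nhdsWithin_le_nhds (s := Set.Ioi (0 : ℝ)))
    have hle := le_of_tendsto_of_tendsto hR hL ?_
    · refine (norm_pos_iff.mpr ?_).not_ge hle
      simp [ht0, I_ne_zero]
    · filter_upwards [self_mem_nhdsWithin] with x hx
      have hx0 : (0 : ℝ) < x := hx
      have hxc : (x : ℂ) ≠ 0 := by exact_mod_cast hx0.ne'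
      have key := one_le_norm_exp_eulerLog_prod hN hsum (x := 1 + x) (by linarith) t
      have e1 := hHs (1 + x) (by simpa using hx0)
      have e2 := hHs (s + x) (by rw [add_re, ← hs1]; simpa using hx0)
      have e3 := hHs (1 + 2 * t * I + x) (by simpa using hx0)
      rw [e1, e2, e3]
      rw [ofReal_add, ofReal_one] at key
      rw [show s + x = 1 + x + t * I by rw [hst]; ring,
        show 1 + 2 * t * I + x = 1 + x + 2 * t * I by ring]
      set E1 := exp (eulerLog N (1 + x))
      set E2 := exp (eulerLog N (1 + x + t * I))
      set E3 := exp (eulerLog N (1 + x + 2 * t * I))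
      have : ((1 + x - 1 : ℂ) * E1) ^ 3 * ((1 + x + t * I - 1) * E2 / x) ^ 3 *
          ((1 + x + t * I - 1) * E2) * ((1 + x + 2 * t * I - 1) * E3) =
          ((x + t * I : ℂ) ^ 4 * (x + 2 * t * I)) * (E1 ^ 3 * E2 ^ 4 * E3) := by
        field_simp
        ring
      rw [this, norm_mul _ (E1 ^ 3 * E2 ^ 4 * E3)]
      exact le_mul_of_one_le_right (norm_nonneg _) key

/-- The boundary behaviour of `∑ i, log (N i) * N i ^ (-s)` at the line `Re s = 1`. -/
theorem exists_continuousOn_tsum_log_mul_cpow (hN : ∀ i, 2 ≤ N i)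
    (hsum : ∀ σ : ℝ, 1 < σ → Summable fun i ↦ (N i : ℝ) ^ (-σ)) {H : ℂ → ℂ} {θ : ℝ} (hθ : θ < 1)
    (hH : DifferentiableOn ℂ H {s | θ < s.re}) (hH1 : H 1 ≠ 0)
    (hHs : ∀ s : ℂ, 1 < s.re → H s = (s - 1) * exp (eulerLog N s)) :
    ∃ g : ℂ → ℂ, ContinuousOn g {s | 1 ≤ s.re} ∧ ∀ s : ℂ, 1 < s.re →
      ∑' i, (Real.log (N i) : ℂ) * (N i : ℂ) ^ (-s) = 1 / (s - 1) + g s := by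
  have hopen : IsOpen {s : ℂ | θ < s.re} := isOpen_lt continuous_const continuous_re
  have hsub : {s : ℂ | 1 ≤ s.re} ⊆ {s | θ < s.re} := fun s hs ↦ hθ.trans_le hs
  -- `r` collects the contribution of the higher powers of `N i` to the logarithmic derivative. It
  -- is dominated by log N · N^(-2) on Re s ≥ 1, so it affects only the continuous part `g`.
  set r : ι → ℂ → ℂ := fun i s ↦
    Real.log (N i) * ((N i : ℂ) ^ (-s)) ^ 2 / (1 - (N i : ℂ) ^ (-s)) with hr
  have hrbound (i : ι) (s : ℂ) (hs : 1 ≤ s.re) :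
      ‖r i s‖ ≤ 2 * (Real.log (N i) * (N i : ℝ) ^ (-2 : ℝ)) := by
    have h1 : (1 : ℝ) ≤ N i := by exact_mod_cast (by lia : 1 ≤ 2).trans (hN i)
    have hlog := Real.log_nonneg h1
    have hz2 : ‖(N i : ℂ) ^ (-s)‖ ^ 2 ≤ (N i : ℝ) ^ (-2 : ℝ) := by
      rw [norm_natCast_cpow_of_pos (by have := hN i; lia), neg_re, ← Real.rpow_natCast,
        ← Real.rpow_mul (by positivity)]
      refine Real.rpow_le_rpow_of_exponent_le h1 ?_
      push_cast
      linarith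
    rw [hr, norm_div, norm_mul, norm_pow, Complex.norm_of_nonneg hlog,
      div_le_iff₀ (by linarith [half_le_norm_one_sub_natCast_cpow_neg (hN i) hs])]
    calc Real.log (N i) * ‖(N i : ℂ) ^ (-s)‖ ^ 2
        ≤ Real.log (N i) * (N i : ℝ) ^ (-2 : ℝ) := by gcongr
      _ = 2 * (Real.log (N i) * (N i : ℝ) ^ (-2 : ℝ)) * (1 / 2) := by ring
      _ ≤ _ := by
          gcongr
          exact half_le_norm_one_sub_natCast_cpow_neg (hN i) hs
  have hrsum : Summable fun i ↦ 2 * (Real.log (N i) * (N i : ℝ) ^ (-2 : ℝ)) :=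
    (summable_log_mul_rpow_neg hN hsum (by norm_num)).mul_left 2
  have hrcont : ContinuousOn (fun s ↦ ∑' i, r i s) {s | 1 ≤ s.re} := by
    refine continuousOn_tsum (fun i ↦ ?_) hrsum hrbound
    have hne : (N i : ℂ) ≠ 0 := by exact_mod_cast (by have := hN i; lia : N i ≠ 0)
    have hc : Continuous fun s : ℂ ↦ (N i : ℂ) ^ (-s) :=
      (continuous_neg).const_cpow (.inl hne)
    exact ((continuous_const.mul (hc.pow 2)).continuousOn).div
      (continuous_const.sub hc).continuousOn
      fun s hs ↦ one_sub_natCast_cpow_neg_ne_zero (hN i) hs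
  refine ⟨fun s ↦ -(deriv H s / H s) - ∑' i, r i s, ?_, fun s hs ↦ ?_⟩
  · refine ContinuousOn.sub (ContinuousOn.neg (ContinuousOn.div ?_ (hH.continuousOn.mono hsub) ?_))
      hrcont
    · exact (hH.deriv hopen).continuousOn.mono hsub
    · exact fun s hs ↦ ne_zero_of_eq_sub_one_mul_exp_eulerLog hN hsum hθ hH hH1 hHs hs
  · have hs1 : s - 1 ≠ 0 := fun h ↦ by
      rw [sub_eq_zero] at h; simp [h] at hs
    have hev : H =ᶠ[𝓝 s] fun s ↦ (s - 1) * exp (eulerLog N s) := by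
      filter_upwards [(isOpen_lt continuous_const continuous_re).mem_nhds hs] with z hz
        using hHs z hz
    have hd := hasDerivAt_eulerLog hN hsum hs
    have hd2 := (((hasDerivAt_id s).sub_const 1).mul hd.cexp).congr_of_eventuallyEq hev
    have hlogsum : Summable fun i ↦ (Real.log (N i) : ℂ) * (N i : ℂ) ^ (-s) := by
      refine Summable.of_norm ((summable_log_mul_rpow_neg hN hsum hs).congr fun i ↦ ?_)
      rw [norm_mul, norm_natCast_cpow_of_pos (by have := hN i; lia), neg_re,
        Complex.norm_of_nonneg (Real.log_natCast_nonneg _)]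
    have hrs : Summable fun i ↦ r i s := .of_norm_bounded hrsum fun i ↦ hrbound i s hs.le
    have hsplit : ∑' i, -(Real.log (N i) * (N i : ℂ) ^ (-s) / (1 - (N i : ℂ) ^ (-s))) =
        -(∑' i, (Real.log (N i) : ℂ) * (N i : ℂ) ^ (-s) + ∑' i, r i s) := by
      rw [tsum_neg, ← hlogsum.tsum_add hrs]
      congr 1
      refine tsum_congr fun i ↦ ?_
      have := one_sub_natCast_cpow_neg_ne_zero (hN i) hs.le
      rw [hr]
      field_simp
      ring
    have hexp := exp_ne_zero (eulerLog N s)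
    simp only [hd2.deriv, hHs s hs, hsplit, id_eq]
    field_simp
    ring

end BeurlingPrimes

/-! ### From the behaviour on Re s = 1 to the asymptotics of summatory functions. -/

section PrimeNumberTheorem

open MeasureTheory Asymptotics

theorem ofReal_exp_cpow (u : ℝ) (a : ℂ) : ((Real.exp u : ℝ) : ℂ) ^ a = Complex.exp (u * a) := by
  rw [Complex.cpow_def_of_ne_zero (by exact_mod_cast (Real.exp_pos u).ne'),
    ← Complex.ofReal_log (Real.exp_pos u).le, Real.log_exp]

/-- A Wiener–Ikehara theorem for Dirichlet series with non-negative coefficients. -/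
theorem tendsto_sum_div_of_LSeries_eq {f : ℕ → ℝ} (hf : ∀ n, 0 ≤ f n) {M : ℝ}
    (hM : ∀ n : ℕ, ∑ k ∈ Finset.Icc 1 n, f k ≤ M * n) {g : ℂ → ℂ}
    (hg : ContinuousOn g {s | 1 ≤ s.re})
    (hfg : ∀ s : ℂ, 1 < s.re → LSeries (fun n ↦ (f n : ℂ)) s = 1 / (s - 1) + g s) :
    Tendsto (fun t : ℝ ↦ (∑ k ∈ Finset.Icc 1 ⌊t⌋₊, f k) / t) atTop (𝓝 1) := by
  set ψ : ℝ → ℝ := fun t ↦ ∑ k ∈ Finset.Icc 1 ⌊t⌋₊, f k with hψ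
  have hψ0 (t : ℝ) : 0 ≤ ψ t := Finset.sum_nonneg fun i _ ↦ hf i
  have hM0 : 0 ≤ M := by simpa using (Finset.sum_nonneg fun i _ ↦ hf i).trans (hM 1)
  have hψM {t : ℝ} (ht : 0 ≤ t) : ψ t ≤ M * t :=
    (hM _).trans (mul_le_mul_of_nonneg_left (Nat.floor_le ht) hM0)
  have hψmono : Monotone ψ := fun a b hab ↦ Finset.sum_le_sum_of_subset_of_nonneg
    (Finset.Icc_subset_Icc_right (Nat.floor_mono hab)) fun i _ _ ↦ hf i
  have hO : (fun n : ℕ ↦ ∑ k ∈ Finset.Icc 1 n, f k) =O[atTop] fun n ↦ (n : ℝ) ^ (1 : ℝ) := by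
    refine .of_bound M (.of_forall fun n ↦ ?_)
    rw [Real.rpow_one, Real.norm_of_nonneg (Finset.sum_nonneg fun i _ ↦ hf i),
      Real.norm_of_nonneg (Nat.cast_nonneg n)]
    exact hM n
  have hcancel (u : ℝ) : Real.exp u * (ψ (Real.exp u) * Real.exp (-u)) = ψ (Real.exp u) := by
    rw [mul_left_comm, ← Real.exp_add, add_neg_cancel, Real.exp_zero, mul_one]
  have key : Tendsto (fun u : ℝ ↦ ψ (Real.exp u) * Real.exp (-u)) atTop (𝓝 1) := by
    -- With t = exp u, the Laplace transform of ψ(exp u) exp(-u) - 1 at s is L(s + 1) / (s + 1) - 1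
    -- / s. Substituting L(s + 1) = 1 / s + g(s + 1) cancels the pole at 0 and gives this `G`.
    refine tendsto_one_of_laplace (M := M) (G := fun s ↦ (g (s + 1) - 1) / (s + 1))
      (fun u ↦ mul_nonneg (hψ0 _) (Real.exp_pos _).le) (fun u ↦ ?_) ?_ ?_ fun s hs ↦ ?_
    · refine (mul_le_mul_of_nonneg_right (hψM (Real.exp_pos u).le) (Real.exp_pos _).le).trans ?_
      rw [mul_assoc, ← Real.exp_add, add_neg_cancel, Real.exp_zero, mul_one]
    · simp_rw [hcancel]
      exact hψmono.comp Real.exp_monotone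
    · refine ContinuousOn.div (ContinuousOn.sub (hg.comp (by fun_prop) fun s hs ↦ ?_)
        continuousOn_const) (by fun_prop) fun s hs h ↦ ?_
      · simpa using hs
      · have := congrArg Complex.re h
        simp only [Complex.add_re, Complex.one_re, Complex.zero_re] at this
        have hs' : 0 ≤ s.re := hs
        linarith
    · have hs0 : s ≠ 0 := fun h ↦ by simp [h] at hs
      have hs1 : s + 1 ≠ 0 := fun h ↦ by
        have := congrArg Complex.re h
        simp only [Complex.add_re, Complex.one_re, Complex.zero_re] at this
        linarith
      have hi1 : IntegrableOn (fun t : ℝ ↦ (ψ t : ℂ) * (t : ℂ) ^ (-(s + 1 + 1))) (Set.Ioi 1) := by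
        refine Integrable.mono' (g := fun t ↦ M * t ^ (-(s.re + 1)))
          ((integrableOn_Ioi_rpow_of_lt (by linarith) zero_lt_one).const_mul M) ?_ ?_
        · refine AEStronglyMeasurable.mul ?_ ?_
          · exact Complex.continuous_ofReal.comp_aestronglyMeasurable
              (locallyIntegrable_sum_Icc_floor hf).aestronglyMeasurable.restrict
          · refine ContinuousOn.aestronglyMeasurable (fun t ht ↦ ?_) measurableSet_Ioi
            exact (Complex.continuousAt_ofReal_cpow_const _ _
              (.inr (zero_lt_one.trans ht).ne')).continuousWithinAt
        · refine (ae_restrict_iff' measurableSet_Ioi).mpr (.of_forall fun t ht ↦ ?_)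
          have ht0 : 0 < t := zero_lt_one.trans ht
          rw [norm_mul, Complex.norm_of_nonneg (hψ0 t), Complex.norm_cpow_eq_rpow_re_of_pos ht0]
          calc ψ t * t ^ (-(s + 1 + 1)).re ≤ M * t * t ^ (-(s + 1 + 1)).re := by
                gcongr; exact hψM ht0.le
            _ = M * t ^ (-(s.re + 1)) := by
                rw [mul_assoc, ← Real.rpow_one_add' ht0.le]
                · congr 2
                  simp
                · simp; linarith
      have hi2 : IntegrableOn (fun t : ℝ ↦ (t : ℂ) ^ (-(s + 1))) (Set.Ioi 1) :=
        integrableOn_Ioi_cpow_of_lt (by simpa using hs) zero_lt_one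
      have hsubst := integral_image_eq_integral_abs_deriv_smul (s := Set.Ioi (0 : ℝ))
        measurableSet_Ioi (fun x _ ↦ (Real.hasDerivAt_exp x).hasDerivWithinAt)
        Real.exp_injective.injOn
        fun t : ℝ ↦ (ψ t : ℂ) * (t : ℂ) ^ (-(s + 1 + 1)) - (t : ℂ) ^ (-(s + 1))
      have himage : Real.exp '' Set.Ioi 0 = Set.Ioi 1 := by
        ext t
        constructor
        · rintro ⟨u, hu, rfl⟩
          exact Real.one_lt_exp_iff.mpr hu
        · intro ht
          exact ⟨Real.log t, Real.log_pos ht, Real.exp_log (zero_lt_one.trans ht)⟩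
      have hL := LSeries_eq_mul_integral_of_nonneg f zero_le_one
        (s := s + 1) (by simpa using hs) hO hf
      rw [hfg _ (by simpa using hs)] at hL
      have hcast : ∫ t : ℝ in Set.Ioi 1, (∑ k ∈ Finset.Icc 1 ⌊t⌋₊, (f k : ℂ)) *
          (t : ℂ) ^ (-(s + 1 + 1)) =
            ∫ t : ℝ in Set.Ioi 1, (ψ t : ℂ) * (t : ℂ) ^ (-(s + 1 + 1)) := by
        simp only [hψ, Complex.ofReal_sum]
      rw [hcast, add_sub_cancel_right] at hL
      rw [himage, integral_sub hi1 hi2, integral_Ioi_cpow_of_lt (by simpa using hs) zero_lt_one,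
        eq_div_of_mul_eq hs1 ((mul_comm _ _).trans hL.symm)] at hsubst
      rw [show -(s + 1) + 1 = -s by ring, Complex.ofReal_one, Complex.one_cpow] at hsubst
      calc ∫ u in Set.Ioi (0 : ℝ), ((ψ (Real.exp u) * Real.exp (-u) - 1 : ℝ) : ℂ) *
            Complex.exp (-s * u)
          = ∫ u in Set.Ioi (0 : ℝ), |Real.exp u| • ((ψ (Real.exp u) : ℂ) *
            ((Real.exp u : ℝ) : ℂ) ^ (-(s + 1 + 1)) - ((Real.exp u : ℝ) : ℂ) ^ (-(s + 1))) := by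
            congr 1
            ext u
            rw [ofReal_exp_cpow, ofReal_exp_cpow, abs_of_pos (Real.exp_pos u), Complex.real_smul,
              Complex.ofReal_sub, Complex.ofReal_mul, Complex.ofReal_exp, Complex.ofReal_exp,
              Complex.ofReal_one, Complex.ofReal_neg, mul_sub, mul_left_comm, ← Complex.exp_add,
              ← Complex.exp_add, sub_mul, mul_assoc, ← Complex.exp_add, one_mul]
            congr 3 <;> ring_nf
        _ = _ := by
            rw [← hsubst]
            field_simp
            ring
  refine (key.comp Real.tendsto_log_atTop).congr' ?_
  filter_upwards [eventually_gt_atTop 0] with t ht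
  simp only [Function.comp_apply, Real.exp_neg, Real.exp_log ht, div_eq_mul_inv, hψ]

theorem tendsto_sum_log_div_of_eulerLog {ι : Type*} {N : ι → ℕ} (hN : ∀ i, 2 ≤ N i)
    (hfin : ∀ n, (N ⁻¹' {n}).Finite) {M : ℝ}
    (hM : ∀ n : ℕ, ∑ k ∈ Finset.Icc 1 n, fiberSum hfin (fun i ↦ Real.log (N i)) k ≤ M * n)
    (hsum : ∀ σ : ℝ, 1 < σ → Summable fun i ↦ (N i : ℝ) ^ (-σ)) {H : ℂ → ℂ} {θ : ℝ} (hθ : θ < 1)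
    (hH : DifferentiableOn ℂ H {s | θ < s.re}) (hH1 : H 1 ≠ 0)
    (hHs : ∀ s : ℂ, 1 < s.re → H s = (s - 1) * Complex.exp (eulerLog N s)) :
    Tendsto (fun t : ℝ ↦ (∑ k ∈ Finset.Icc 1 ⌊t⌋₊, fiberSum hfin (fun i ↦ Real.log (N i)) k) / t)
      atTop (𝓝 1) := by
  obtain ⟨g, hg, hgs⟩ := exists_continuousOn_tsum_log_mul_cpow hN hsum hθ hH hH1 hHs
  have hw (i : ι) : 0 ≤ Real.log (N i) := Real.log_natCast_nonneg _
  have hN0 (i : ι) : N i ≠ 0 := by have := hN i; lia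
  refine tendsto_sum_div_of_LSeries_eq (fiberSum_nonneg hfin hw) hM hg fun s hs ↦ ?_
  rw [← hgs s hs]
  refine (hasSum_LSeries_fiberSum hfin hN0 hw ?_).tsum_eq.symm
  refine LSeriesSummable_of_sum_norm_bigO_and_nonneg (r := 1) (.of_bound M (.of_forall fun n ↦ ?_))
    (fiberSum_nonneg hfin hw) zero_le_one hs
  rw [Real.rpow_one, Real.norm_of_nonneg (Finset.sum_nonneg fun i _ ↦ fiberSum_nonneg hfin hw i),
    Real.norm_of_nonneg (Nat.cast_nonneg n)]
  exact hM n

end PrimeNumberTheorem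

/-! ### The prime ideal theorem and the comparison of the two averages. -/

section PrimeIdealTheorem

open Ideal Module Asymptotics
open scoped nonZeroDivisors

variable (K : Type*) [Field K] [NumberField K]

theorem exists_prime_dvd_natCast_mem {R : Type*} [CommRing R] {P : Ideal R} (hP : P.IsPrime)
    {m : ℕ} (hm : m ≠ 0) (hmP : (m : R) ∈ P) : ∃ ℓ : ℕ, ℓ.Prime ∧ ℓ ∣ m ∧ (ℓ : R) ∈ P := by
  induction m using induction_on_primes with
  | zero => exact absurd rfl hm
  | one => exact absurd ((Ideal.eq_top_iff_one P).mpr (by simpa using hmP)) hP.ne_top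
  | prime_mul p a hp ih =>
    rw [Nat.cast_mul] at hmP
    rcases hP.mem_or_mem hmP with h | h
    · exact ⟨p, hp, dvd_mul_right _ _, h⟩
    · obtain ⟨ℓ, h1, h2, h3⟩ := ih (right_ne_zero_of_mul hm) h
      exact ⟨ℓ, h1, h2.mul_left _, h3⟩

variable {K}

theorem two_le_primeNorm (p : HeightOneSpectrum (𝓞 K)) : 2 ≤ NumberFieldPrimes.primeNorm p := by
  have h0 : absNorm p.asIdeal ≠ 0 := absNorm_ne_zero_iff_mem_nonZeroDivisors.mpr
    (mem_nonZeroDivisors_of_ne_zero p.ne_bot)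
  have h1 : absNorm p.asIdeal ≠ 1 := fun h ↦ p.isPrime.ne_top (absNorm_eq_one_iff.mp h)
  rw [NumberFieldPrimes.primeNorm]
  lia

theorem finite_primeNorm_eq (n : ℕ) :
    ((NumberFieldPrimes.primeNorm (k := K)) ⁻¹' {n}).Finite :=
  (NumberFieldPrimes.finite_primeNorm_lt K (n + 1)).subset fun p hp ↦ by
    have : NumberFieldPrimes.primeNorm p = n := hp
    change NumberFieldPrimes.primeNorm p < n + 1
    lia

theorem mem_primesBelow {N : ℕ} {p : HeightOneSpectrum (𝓞 K)} :
    p ∈ NumberFieldPrimes.primesBelow K N ↔ NumberFieldPrimes.primeNorm p < N := by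
  rw [NumberFieldPrimes.primesBelow, Set.Finite.mem_toFinset]
  rfl

/-- A prime of norm q ≤ n contains a rational prime dividing q, hence at most n, so it divides the
ideal generated by `primorial n`. Distinct primes divide jointly, and taking norms gives the bound.
This supplies the Chebyshev estimate required by the Tauberian theorem. -/
theorem prod_primeNorm_primesBelow_le (n : ℕ) :
    ∏ p ∈ NumberFieldPrimes.primesBelow K (n + 1), NumberFieldPrimes.primeNorm p ≤
      primorial n ^ finrank ℚ K := by
  have hdvd : ∏ p ∈ NumberFieldPrimes.primesBelow K (n + 1), p.asIdeal ∣
      Ideal.span {((primorial n : ℕ) : 𝓞 K)} := by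
    rw [show ∏ p ∈ NumberFieldPrimes.primesBelow K (n + 1), p.asIdeal =
      ∏ I ∈ (NumberFieldPrimes.primesBelow K (n + 1)).map
        ⟨HeightOneSpectrum.asIdeal, fun _ _ ↦ HeightOneSpectrum.ext⟩, I from
      (Finset.prod_map _ ⟨HeightOneSpectrum.asIdeal, fun _ _ ↦ HeightOneSpectrum.ext⟩
        fun I ↦ I).symm]
    refine Finset.prod_primes_dvd _ ?_ ?_
    · intro I hI
      obtain ⟨p, -, rfl⟩ := Finset.mem_map.mp hI
      exact p.prime
    · intro I hI
      obtain ⟨p, hp, rfl⟩ := Finset.mem_map.mp hI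
      have hp' := mem_primesBelow.mp hp
      rw [NumberFieldPrimes.primeNorm] at hp'
      have hpos : 0 < absNorm p.asIdeal := two_pos.trans_le (two_le_primeNorm p)
      obtain ⟨ℓ, hℓ, hℓp, hmem⟩ := exists_prime_dvd_natCast_mem p.isPrime
        (m := absNorm p.asIdeal) hpos.ne'
        (absNorm_mem _)
      change p.asIdeal ∣ _
      rw [Ideal.dvd_span_singleton]
      have hle : ℓ ≤ n := by
        have h1 := Nat.le_of_dvd hpos hℓp
        lia
      obtain ⟨c, hc⟩ := hℓ.dvd_primorial_iff.mpr hle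
      rw [hc, Nat.cast_mul]
      exact p.asIdeal.mul_mem_right _ hmem
  have hnorm : absNorm (Ideal.span {((primorial n : ℕ) : 𝓞 K)}) = primorial n ^ finrank ℚ K := by
    rw [absNorm_span_natCast, RingOfIntegers.rank]
  have h := Nat.le_of_dvd (by rw [hnorm]; exact pow_pos (primorial_pos n) _)
    (map_dvd (absNorm (S := 𝓞 K)) hdvd)
  rwa [hnorm, map_prod] at h

theorem sum_log_primeNorm_primesBelow_le (n : ℕ) :
    ∑ p ∈ NumberFieldPrimes.primesBelow K (n + 1), Real.log (NumberFieldPrimes.primeNorm p) ≤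
      finrank ℚ K * Real.log 4 * n := by
  rw [← Real.log_prod fun p _ ↦ by have := two_le_primeNorm p; positivity, ← Nat.cast_prod]
  have hpos : 0 < ∏ p ∈ NumberFieldPrimes.primesBelow K (n + 1), NumberFieldPrimes.primeNorm p :=
    Finset.prod_pos fun p _ ↦ by have := two_le_primeNorm p; lia
  have h : ∏ p ∈ NumberFieldPrimes.primesBelow K (n + 1), NumberFieldPrimes.primeNorm p ≤
      (4 ^ n) ^ finrank ℚ K :=
    (prod_primeNorm_primesBelow_le n).trans (Nat.pow_le_pow_left (primorial_le_four_pow n) _)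
  refine (Real.log_le_log (by exact_mod_cast hpos) (Nat.cast_le.mpr h)).trans_eq ?_
  push_cast
  rw [Real.log_pow, Real.log_pow]
  ring

theorem sum_fiberSum_primeNorm (w : HeightOneSpectrum (𝓞 K) → ℝ) (n : ℕ) :
    ∑ k ∈ Finset.Icc 1 n, fiberSum finite_primeNorm_eq w k =
      ∑ p ∈ NumberFieldPrimes.primesBelow K (n + 1), w p :=
  sum_fiberSum _ (fun p ↦ by have := two_le_primeNorm p; lia) w fun p ↦ by
    rw [mem_primesBelow, Nat.lt_succ_iff]

theorem finite_absNorm_eq_nonZeroDivisors (n : ℕ) :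
    ((fun I : (Ideal (𝓞 K))⁰ ↦ absNorm (I : Ideal (𝓞 K))) ⁻¹' {n}).Finite :=
  (finite_setOfPred_absNorm_le₀ (S := 𝓞 K) n).subset fun I hI ↦ by
    have : absNorm (I : Ideal (𝓞 K)) = n := hI
    exact this.le

theorem sum_fiberSum_absNorm (t : ℝ) (ht : 0 ≤ t) :
    ∑ k ∈ Finset.Icc 1 ⌊t⌋₊, fiberSum (finite_absNorm_eq_nonZeroDivisors (K := K)) (fun _ ↦ 1) k =
      Nat.card {I : (Ideal (𝓞 K))⁰ // absNorm (I : Ideal (𝓞 K)) ≤ t} := by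
  have hfin := finite_setOfPred_absNorm_le₀ (S := 𝓞 K) ⌊t⌋₊
  rw [sum_fiberSum _ (fun I ↦ (absNorm_pos_of_nonZeroDivisors I).ne') (fun _ ↦ 1)
    (T := hfin.toFinset)
    fun I ↦ by simp]
  simp only [Finset.sum_const, nsmul_eq_mul, mul_one]
  rw [← Set.ncard_eq_toFinset_card _ hfin]
  simp_rw [← Nat.le_floor_iff ht]
  rfl

/-- The map `I ↦ N(I) ^ (-s)` on nonzero ideals. -/
noncomputable def absNormCpow (s : ℂ) : (Ideal (𝓞 K))⁰ →* ℂ where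
  toFun I := (absNorm (I : Ideal (𝓞 K)) : ℂ) ^ (-s)
  map_one' := by simp
  map_mul' I J := by
    rw [Submonoid.coe_mul, map_mul, Nat.cast_mul, Complex.natCast_mul_natCast_cpow]

variable (K) in
theorem exists_eq_sub_one_mul_tsum_absNorm :
    (∀ σ : ℝ, 1 < σ → Summable fun I : (Ideal (𝓞 K))⁰ ↦
      (absNorm (I : Ideal (𝓞 K)) : ℝ) ^ (-σ)) ∧
    ∃ (H : ℂ → ℂ) (θ : ℝ), θ < 1 ∧ DifferentiableOn ℂ H {s | θ < s.re} ∧ H 1 ≠ 0 ∧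
      ∀ s : ℂ, 1 < s.re → H s = (s - 1) *
        ∑' I : (Ideal (𝓞 K))⁰, (absNorm (I : Ideal (𝓞 K)) : ℂ) ^ (-s) := by
  obtain ⟨ρ, θ, hρ, -, hθ, hO⟩ := exists_card_absNorm_le_sub_isBigO K
  have hnn := fiberSum_nonneg (finite_absNorm_eq_nonZeroDivisors (K := K)) (w := fun _ ↦ 1)
    fun _ ↦ zero_le_one
  have hN0 (I : (Ideal (𝓞 K))⁰) : absNorm (I : Ideal (𝓞 K)) ≠ 0 :=
    (absNorm_pos_of_nonZeroDivisors I).ne'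
  have hO' : (fun t : ℝ ↦ ∑ k ∈ Finset.Icc 1 ⌊t⌋₊,
      fiberSum (finite_absNorm_eq_nonZeroDivisors (K := K)) (fun _ ↦ 1) k - ρ * t) =O[atTop]
      fun t ↦ t ^ θ := by
    refine hO.congr' ?_ EventuallyEq.rfl
    filter_upwards [eventually_ge_atTop 0] with t ht
    rw [sum_fiberSum_absNorm t ht]
  obtain ⟨hLS, H, hH, hH1, hHs⟩ := exists_differentiableOn_sub_one_mul_LSeries hnn hθ hO'
  refine ⟨fun σ hσ ↦ ?_, H, θ, hθ, hH, by rw [hH1]; exact_mod_cast hρ.ne', fun s hs ↦ ?_⟩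
  · have h := summable_of_LSeriesSummable_fiberSum (finite_absNorm_eq_nonZeroDivisors (K := K))
      hN0 (fun _ ↦ zero_le_one) (hLS σ hσ)
    simp only [one_mul, Complex.ofReal_re] at h
    exact h
  · have h := (hasSum_LSeries_fiberSum (finite_absNorm_eq_nonZeroDivisors (K := K))
      hN0 (fun _ ↦ zero_le_one) (hLS s hs)).tsum_eq
    simp only [Complex.ofReal_one, one_mul] at h
    rw [hHs s hs, ← h]

theorem summable_primeNorm_rpow_neg {σ : ℝ}
    (hsum : Summable fun I : (Ideal (𝓞 K))⁰ ↦ (absNorm (I : Ideal (𝓞 K)) : ℝ) ^ (-σ)) :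
    Summable fun p : HeightOneSpectrum (𝓞 K) ↦ (NumberFieldPrimes.primeNorm p : ℝ) ^ (-σ) := by
  refine (hsum.comp_injective HeightOneSpectrum.nonzeroIdeal_injective).congr fun p ↦ ?_
  rw [Function.comp_apply, HeightOneSpectrum.coe_nonzeroIdeal, NumberFieldPrimes.primeNorm]

/-- Exponentiating the sum of logarithms gives the Euler product of the zeta function, without
choosing a branch of its logarithm. -/
theorem exp_eulerLog_primeNorm
    (hsum : ∀ σ : ℝ, 1 < σ → Summable fun I : (Ideal (𝓞 K))⁰ ↦
      (absNorm (I : Ideal (𝓞 K)) : ℝ) ^ (-σ)) {s : ℂ} (hs : 1 < s.re) :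
    Complex.exp (eulerLog (NumberFieldPrimes.primeNorm (k := K)) s) =
      ∑' I : (Ideal (𝓞 K))⁰, (absNorm (I : Ideal (𝓞 K)) : ℂ) ^ (-s) := by
  have h2 := hasProd_one_sub_inv_nonzeroIdeal (f := absNormCpow (K := K) s) ?_ ?_
  · have h3 := (summable_neg_log_one_sub two_le_primeNorm
      (fun σ hσ ↦ summable_primeNorm_rpow_neg (hsum σ hσ)) hs).hasSum.cexp
    have h4 : Complex.exp ∘ (fun p : HeightOneSpectrum (𝓞 K) ↦
        -Complex.log (1 - (NumberFieldPrimes.primeNorm p : ℂ) ^ (-s))) =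
        fun p ↦ (1 - absNormCpow s p.nonzeroIdeal)⁻¹ := by
      ext p
      rw [Function.comp_apply, Complex.exp_neg, Complex.exp_log
        (one_sub_natCast_cpow_neg_ne_zero (two_le_primeNorm p) hs.le)]
      rfl
    rw [h4] at h3
    exact h3.unique h2
  · refine (hsum s.re hs).congr fun I ↦ ?_
    change _ = ‖(absNorm (I : Ideal (𝓞 K)) : ℂ) ^ (-s)‖
    rw [Complex.norm_natCast_cpow_of_pos (absNorm_pos_of_nonZeroDivisors I), Complex.neg_re]
  · intro p
    exact (norm_natCast_cpow_neg_le_half (two_le_primeNorm p) hs.le).trans_lt (by norm_num)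

variable (K) in
/-- The prime ideal theorem, for the Chebyshev function of a number field. -/
theorem tendsto_sum_log_primeNorm_div :
    Tendsto (fun N : ℕ ↦ (∑ p ∈ NumberFieldPrimes.primesBelow K N,
      Real.log (NumberFieldPrimes.primeNorm p)) / N) atTop (𝓝 1) := by
  obtain ⟨hsum, H, θ, hθ, hH, hH1, hHs⟩ := exists_eq_sub_one_mul_tsum_absNorm K
  have h := tendsto_sum_log_div_of_eulerLog two_le_primeNorm finite_primeNorm_eq
    (M := finrank ℚ K * Real.log 4)
    (fun n ↦ (sum_fiberSum_primeNorm _ n).trans_le (sum_log_primeNorm_primesBelow_le n))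
    (fun σ hσ ↦ summable_primeNorm_rpow_neg (hsum σ hσ)) hθ hH hH1
    fun s hs ↦ (hHs s hs).trans (by rw [exp_eulerLog_primeNorm hsum hs])
  have h1 := h.comp (tendsto_natCast_atTop_atTop (R := ℝ))
  -- The sums up to n include norm n whereas `primesBelow` is strict. The resulting shift costs a
  -- factor n / (n + 1).
  rw [← tendsto_add_atTop_iff_nat 1]
  have h2 : Tendsto (fun n : ℕ ↦ (n : ℝ) / ((n : ℝ) + 1)) atTop (𝓝 1) :=
    tendsto_natCast_div_add_atTop 1
  have h3 := h1.mul h2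
  rw [one_mul] at h3
  refine h3.congr' ?_
  filter_upwards [eventually_gt_atTop 0] with n hn
  have hn' : (n : ℝ) ≠ 0 := by exact_mod_cast hn.ne'
  simp only [Function.comp_apply, Nat.floor_natCast, sum_fiberSum_primeNorm]
  push_cast
  rw [div_mul_div_cancel₀ hn']

-- The quantity is ∑ (log N - log q) / N, which is nonnegative. Primes of norm at most N^(1-δ)
-- number O(N^(1-δ)), and the others satisfy log N ≤ log q / (1 - δ). With θ(N) ~ N the upper limit
-- is at most 1 / (1 - δ) - 1, for every δ in (0, 1).
variable (K) in
theorem tendsto_primeCount_mul_log_sub_div :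
    Tendsto (fun N : ℕ ↦ ((NumberFieldPrimes.primeCount K N : ℝ) * Real.log N -
      ∑ p ∈ NumberFieldPrimes.primesBelow K N, Real.log (NumberFieldPrimes.primeNorm p)) / N)
      atTop (𝓝 0) := by
  set Θ : ℕ → ℝ := fun N ↦ ∑ p ∈ NumberFieldPrimes.primesBelow K N,
    Real.log (NumberFieldPrimes.primeNorm p) with hΘ
  have hlognn (p : HeightOneSpectrum (𝓞 K)) : 0 ≤ Real.log (NumberFieldPrimes.primeNorm p) :=
    Real.log_natCast_nonneg _
  set M : ℝ := finrank ℚ K * Real.log 4 with hM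
  have hM0 : 0 ≤ M := mul_nonneg (Nat.cast_nonneg _) (Real.log_nonneg (by norm_num))
  have hlog2 : 0 < Real.log 2 := Real.log_pos (by norm_num)
  have hcard (x : ℝ) (hx : 0 ≤ x) (S : Finset (HeightOneSpectrum (𝓞 K)))
      (hS : ∀ p ∈ S, (NumberFieldPrimes.primeNorm p : ℝ) ≤ x) :
      (S.card : ℝ) ≤ M / Real.log 2 * x := by
    have h1 : (S.card : ℝ) * Real.log 2 ≤ M * x := by
      calc (S.card : ℝ) * Real.log 2 = ∑ p ∈ S, Real.log 2 := by simp
        _ ≤ ∑ p ∈ S, Real.log (NumberFieldPrimes.primeNorm p) :=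
            Finset.sum_le_sum fun p _ ↦ Real.log_le_log two_pos
              (by exact_mod_cast two_le_primeNorm p)
        _ ≤ Θ (⌊x⌋₊ + 1) := by
            refine Finset.sum_le_sum_of_subset_of_nonneg (fun p hp ↦ ?_) fun p _ _ ↦ hlognn p
            rw [mem_primesBelow, Nat.lt_succ_iff]
            exact Nat.le_floor (hS p hp)
        _ ≤ M * ⌊x⌋₊ := sum_log_primeNorm_primesBelow_le _
        _ ≤ M * x := mul_le_mul_of_nonneg_left (Nat.floor_le hx) hM0
    rw [div_mul_eq_mul_div, le_div_iff₀ hlog2]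
    exact h1
  have hcount (δ : ℝ) (hδ0 : 0 < δ) (hδ1 : δ < 1) (N : ℕ) (hN : 0 < N) :
      (NumberFieldPrimes.primeCount K N : ℝ) * Real.log N ≤
        M / Real.log 2 * (N : ℝ) ^ (1 - δ) * Real.log N + Θ N / (1 - δ) := by
    have hN' : (0 : ℝ) < N := by exact_mod_cast hN
    have hlogN : 0 ≤ Real.log N := Real.log_natCast_nonneg N
    have hδ : 0 < 1 - δ := by linarith
    set S := (NumberFieldPrimes.primesBelow K N).filter fun p ↦
      (NumberFieldPrimes.primeNorm p : ℝ) ≤ (N : ℝ) ^ (1 - δ)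
    calc (NumberFieldPrimes.primeCount K N : ℝ) * Real.log N
        = ∑ p ∈ NumberFieldPrimes.primesBelow K N, Real.log N := by
          simp [NumberFieldPrimes.primeCount]
      _ ≤ ∑ p ∈ NumberFieldPrimes.primesBelow K N,
          ((if (NumberFieldPrimes.primeNorm p : ℝ) ≤ (N : ℝ) ^ (1 - δ) then Real.log N else 0) +
            Real.log (NumberFieldPrimes.primeNorm p) / (1 - δ)) := by
          refine Finset.sum_le_sum fun p _ ↦ ?_
          split_ifs with h
          · have := div_nonneg (hlognn p) hδ.le
            linarith
          · rw [zero_add, le_div_iff₀ hδ, mul_comm, ← Real.log_rpow hN']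
            exact Real.log_le_log (by positivity) (not_le.mp h).le
      _ = S.card * Real.log N + Θ N / (1 - δ) := by
          rw [Finset.sum_add_distrib, ← Finset.sum_filter, Finset.sum_const, nsmul_eq_mul,
            Finset.sum_div]
      _ ≤ _ := by
          gcongr
          exact hcard _ (by positivity) _ fun p hp ↦ (Finset.mem_filter.mp hp).2
  have hnonneg (N : ℕ) : 0 ≤ ((NumberFieldPrimes.primeCount K N : ℝ) * Real.log N - Θ N) / N := by
    refine div_nonneg (sub_nonneg.mpr ?_) (Nat.cast_nonneg _)
    rw [NumberFieldPrimes.primeCount, ← nsmul_eq_mul]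
    refine Finset.sum_le_card_nsmul _ _ _ fun p hp ↦ Real.log_le_log ?_ ?_
    · have := two_le_primeNorm p
      positivity
    · exact_mod_cast (mem_primesBelow.mp hp).le
  have hbound (δ : ℝ) (hδ0 : 0 < δ) (hδ1 : δ < 1) :
      Tendsto (fun N : ℕ ↦ M / Real.log 2 * (Real.log N / (N : ℝ) ^ δ) +
        (Θ N / N) * (1 / (1 - δ) - 1)) atTop (𝓝 (1 / (1 - δ) - 1)) := by
    have h1 : Tendsto (fun N : ℕ ↦ Real.log N / (N : ℝ) ^ δ) atTop (𝓝 0) :=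
      (isLittleO_log_rpow_atTop hδ0).tendsto_div_nhds_zero.comp tendsto_natCast_atTop_atTop
    simpa using (h1.const_mul (M / Real.log 2)).add
      ((tendsto_sum_log_primeNorm_div K).mul_const (1 / (1 - δ) - 1))
  rw [Metric.tendsto_atTop']
  intro ε hε
  obtain ⟨δ, hδ0, hδ1, hδε⟩ : ∃ δ : ℝ, 0 < δ ∧ δ < 1 ∧ 1 / (1 - δ) - 1 < ε := by
    -- For this δ one has 1 / (1 - δ) - 1 = ε / (2 + ε) < ε.
    refine ⟨ε / (2 + 2 * ε), by positivity, by rw [div_lt_one (by positivity)]; linarith, ?_⟩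
    have h : 1 - ε / (2 + 2 * ε) = (2 + ε) / (2 + 2 * ε) := by field_simp; ring
    rw [h, one_div_div, sub_lt_iff_lt_add, div_lt_iff₀ (by positivity)]
    nlinarith
  obtain ⟨N₀, hN₀⟩ := eventually_atTop.mp ((hbound δ hδ0 hδ1).eventually_lt_const hδε)
  refine ⟨N₀, fun N hN ↦ ?_⟩
  have hpos : 0 < N := by lia
  have hN' : (0 : ℝ) < N := by exact_mod_cast hpos
  rw [Real.dist_0_eq_abs, abs_of_nonneg (hnonneg N)]
  refine lt_of_le_of_lt ?_ (hN₀ N hN.le)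
  rw [div_le_iff₀ hN']
  have h := hcount δ hδ0 hδ1 N hpos
  have e : (M / Real.log 2 * (Real.log N / (N : ℝ) ^ δ) + (Θ N / N) * (1 / (1 - δ) - 1)) * N =
      M / Real.log 2 * (N : ℝ) ^ (1 - δ) * Real.log N + Θ N / (1 - δ) - Θ N := by
    rw [Real.rpow_sub hN', Real.rpow_one]
    have : (N : ℝ) ^ δ ≠ 0 := (Real.rpow_pos_of_pos hN' _).ne'
    have h1 : 1 - δ ≠ 0 := by linarith
    field_simp
    ring
  rw [e]
  linarith

variable (K) in
/-- The prime ideal theorem. -/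
theorem tendsto_primeCount_mul_log_div :
    Tendsto (fun N : ℕ ↦ (NumberFieldPrimes.primeCount K N : ℝ) * Real.log N / N) atTop (𝓝 1) := by
  have := (tendsto_primeCount_mul_log_sub_div K).add (tendsto_sum_log_primeNorm_div K)
  rw [zero_add] at this
  refine this.congr fun N ↦ ?_
  ring

/-- The difference is ∑ s (log N - log q) / N. Each log N - log q is nonnegative and 0 ≤ s ≤ M, so
it is squeezed between 0 and M times the same sum without weights. -/
theorem tendsto_log_div_mul_sum_sub_logAverage {s : HeightOneSpectrum (𝓞 K) → ℝ}
    (hs : ∀ p, 0 ≤ s p) {M : ℝ} (hM : ∀ p, s p ≤ M) :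
    Tendsto (fun N : ℕ ↦ Real.log N / N * ∑ p ∈ NumberFieldPrimes.primesBelow K N, s p -
      NumberFieldPrimes.logAverage K s N) atTop (𝓝 0) := by
  have hlim := (tendsto_primeCount_mul_log_sub_div K).const_mul M
  rw [mul_zero] at hlim
  have heq (N : ℕ) : Real.log N / N * ∑ p ∈ NumberFieldPrimes.primesBelow K N, s p -
      NumberFieldPrimes.logAverage K s N = (∑ p ∈ NumberFieldPrimes.primesBelow K N,
        s p * (Real.log N - Real.log (NumberFieldPrimes.primeNorm p))) / N := by
    rw [NumberFieldPrimes.logAverage]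
    simp only [mul_sub, Finset.sum_sub_distrib, ← Finset.sum_mul]
    ring
  have hlog {N : ℕ} {p : HeightOneSpectrum (𝓞 K)} (hp : p ∈ NumberFieldPrimes.primesBelow K N) :
      0 ≤ Real.log N - Real.log (NumberFieldPrimes.primeNorm p) := by
    refine sub_nonneg.mpr (Real.log_le_log ?_ ?_)
    · have := two_le_primeNorm p
      positivity
    · exact_mod_cast (mem_primesBelow.mp hp).le
  refine squeeze_zero (fun N ↦ ?_) (fun N ↦ ?_) hlim
  · rw [heq]
    exact div_nonneg (Finset.sum_nonneg fun p hp ↦ mul_nonneg (hs p) (hlog hp))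
      (Nat.cast_nonneg _)
  · rw [heq, ← mul_div_assoc]
    gcongr
    calc ∑ p ∈ NumberFieldPrimes.primesBelow K N,
          s p * (Real.log N - Real.log (NumberFieldPrimes.primeNorm p))
        ≤ ∑ p ∈ NumberFieldPrimes.primesBelow K N,
          M * (Real.log N - Real.log (NumberFieldPrimes.primeNorm p)) :=
          Finset.sum_le_sum fun p hp ↦ mul_le_mul_of_nonneg_right (hM p) (hlog hp)
      _ = _ := by
          rw [← Finset.mul_sum, Finset.sum_sub_distrib, Finset.sum_const, nsmul_eq_mul,
            NumberFieldPrimes.primeCount]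

/-- The identity also covers π_k(N) = 0, where both sides are 0 because the sum is empty. -/
theorem log_div_mul_sum_eq {s : HeightOneSpectrum (𝓞 K) → ℝ} (N : ℕ) :
    Real.log N / N * ∑ p ∈ NumberFieldPrimes.primesBelow K N, s p =
      NumberFieldPrimes.primeAverage K s N *
        ((NumberFieldPrimes.primeCount K N : ℝ) * Real.log N / N) := by
  rw [NumberFieldPrimes.primeAverage]
  rcases eq_or_ne (NumberFieldPrimes.primeCount K N) 0 with h | h
  · rw [NumberFieldPrimes.primeCount, Finset.card_eq_zero] at h
    simp [NumberFieldPrimes.primeCount, h]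
  · have : (NumberFieldPrimes.primeCount K N : ℝ) ≠ 0 := by exact_mod_cast h
    field_simp

end PrimeIdealTheorem

theorem lemma2 (k : Type*) [Field k] [NumberField k]
    (s : HeightOneSpectrum (𝓞 k) → ℝ)
    (hs_nonneg : ∀ 𝔭, 0 ≤ s 𝔭)
    (hs_bdd : ∃ M : ℝ, ∀ 𝔭, s 𝔭 ≤ M)
    (hconv : (∃ L : ℝ, Tendsto (NumberFieldPrimes.logAverage k s) atTop (𝓝 L)) ∨
      (∃ L : ℝ, Tendsto (NumberFieldPrimes.primeAverage k s) atTop (𝓝 L))) :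
    ∃ L : ℝ, Tendsto (NumberFieldPrimes.logAverage k s) atTop (𝓝 L) ∧
      Tendsto (NumberFieldPrimes.primeAverage k s) atTop (𝓝 L) := by
  obtain ⟨M, hM⟩ := hs_bdd
  have hdiff := tendsto_log_div_mul_sum_sub_logAverage hs_nonneg hM
  have hcount := tendsto_primeCount_mul_log_div k
  simp only [log_div_mul_sum_eq] at hdiff
  rcases hconv with ⟨L, hL⟩ | ⟨L, hL⟩
  · refine ⟨L, hL, ?_⟩
    have h := (hdiff.add hL).div hcount one_ne_zero
    rw [zero_add, div_one] at h
    refine h.congr' ?_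
    -- The factor π_k(N) log N / N tends to 1, so it is eventually nonzero and can be divided out.
    filter_upwards [hcount.eventually_ne one_ne_zero] with N hN
    rw [Pi.div_apply, sub_add_cancel, mul_div_cancel_right₀ _ hN]
  · refine ⟨L, ?_, hL⟩
    have h := (hL.mul hcount).sub hdiff
    rw [mul_one, sub_zero] at h
    exact h.congr fun N ↦ sub_sub_cancel _ _
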